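/- Let $m,n\ge 0$ be integers, $J=\begin{pmatrix}0&I_n\\-I_n&0\end{pmatrix}$ and $Q=\begin{pmatrix}0&I_m\\I_m&0\end{pmatrix}$. Identify $V=(\mathbb C^{2n})^{\oplus 2m}$ with the space of complex $2n\times 2m$ matrices $X=(X',X'')$, where $X',X''$ are the two $2n\times m$ blocks, on which $Sp_{2n}=\{g : g^tJg=J\}$ acts by left multiplication, and equip $V$ with the symplectic form $\sigma(X,Y)=\operatorname{tr}((X'')^tJY')-\operatorname{tr}((Y'')^tJX')$. The moment map of this action, i.e. the unique $Sp_{2n}$-equivariant map $\mu\colon V\to\mathfrak{sp}_{2n}^*$ with $d\mu_X(\xi)(A)=\sigma(\xi,AX)$ for all $X,\xi\in V$, $A\in\mathfrak{sp}_{2n}$, is $\mu(X)(A)=\operatorname{tr}\bigl(A\cdot\tfrac12XQX^tJ\bigr)$, that is, $X\mapsto \tfrac12 XQX^tJ$ under the identification $\mathfrak{sp}_{2n}^*\cong\mathfrak{sp}_{2n}$ by the trace form. Let $\mathcal I_\mu\subset\mathbb C[V]$ be the ideal generated by the entries of $XQX^tJ$, and let $\mu^{-1}(0)=\operatorname{Spec}(\mathbb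 C[V]/\mathcal I_\mu)$ be the scheme-theoretic zero fibre. (1) If $m\ge 2n$, then $\mu^{-1}(0)$ is reduced and is a complete intersection in $V$ (its ideal can be generated by $\operatorname{codim}_V\mu^{-1}(0)$ elements), of dimension $\dim V-\dim\mathfrak{sp}_{2n}=4mn-2n^2-n$. (2) If $m\ge 2n+1$, then $\mu^{-1}(0)$ is moreover normal (all its local rings are integrally closed domains). -/

import Mathlib

namespace SpMoment

/-- The matrix `J = (0, I_n; -I_n, 0)` of the symplectic form. -/
def J (n : ℕ) (R : Type*) [CommRing R] : Matrix (Fin n ⊕ Fin n) (Fin n ⊕ Fin n) R :=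
  Matrix.fromBlocks 0 1 (-1) 0

/-- The matrix `Q = (0, I_m; I_m, 0)` of the quadratic form. -/
def Q (m : ℕ) (R : Type*) [CommRing R] : Matrix (Fin m ⊕ Fin m) (Fin m ⊕ Fin m) R :=
  Matrix.fromBlocks 0 1 1 0

/-- The space `(ℂ^{2n})^{⊕ 2m}`: the columns of the matrix `X = (X', X'')` are the `2m` vectors,
and `Sp_{2n}` acts by left multiplication. -/
abbrev V (n m : ℕ) : Type := Matrix (Fin n ⊕ Fin n) (Fin m ⊕ Fin m) ℂ

/-- The Lie algebra `𝔰𝔭_{2n}` of `Sp_{2n}`, as a vector space: all `A` with `Aᵗ J = J (-A)`. -/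
abbrev sp (n : ℕ) : Submodule ℂ (Matrix (Fin n ⊕ Fin n) (Fin n ⊕ Fin n) ℂ) :=
  skewAdjointMatricesSubmodule (J n ℂ)

/-- The canonical symplectic form `σ((v, η), (w, θ)) = η(w) - θ(v)` of the symplectic double of
`(ℂ^{2n})^{⊕ m}`, which is identified with its dual by the invariant pairing
`(Y, Z) ↦ tr(Zᵗ J Y)`. -/
def symplecticForm (n m : ℕ) (X Y : V n m) : ℂ :=
  (X.toCols₂.transpose * J n ℂ * Y.toCols₁).trace -
    (Y.toCols₂.transpose * J n ℂ * X.toCols₁).trace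

/-- `μ : V → 𝔰𝔭_{2n}^*` is a moment map of the action of `Sp_{2n}` on `(ℂ^{2n})^{⊕ 2m}`: it is
equivariant for the coadjoint action, and `dμ_X(ξ)(A) = σ(ξ, A X)`. -/
structure IsMomentMap (n m : ℕ) (μ : V n m → Module.Dual ℂ (sp n)) : Prop where
  equivariant : ∀ g ∈ Matrix.symplecticGroup (Fin n) ℂ, ∀ (X : V n m) (A B : sp n),
    (B : Matrix (Fin n ⊕ Fin n) (Fin n ⊕ Fin n) ℂ) =
      g⁻¹ * (A : Matrix (Fin n ⊕ Fin n) (Fin n ⊕ Fin n) ℂ) * g →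
    μ (g * X) A = μ X B
  deriv : ∀ (X ξ : V n m) (A : sp n),
    HasLineDerivAt ℂ (fun Y => μ Y A)
      (symplecticForm n m ξ ((A : Matrix (Fin n ⊕ Fin n) (Fin n ⊕ Fin n) ℂ) * X)) X ξ

/-- The map `X ↦ X Q Xᵗ J`, for matrices with entries in any commutative ring. -/
def momentMatrix {n m : ℕ} {R : Type*} [CommRing R]
    (X : Matrix (Fin n ⊕ Fin n) (Fin m ⊕ Fin m) R) :
    Matrix (Fin n ⊕ Fin n) (Fin n ⊕ Fin n) R :=
  X * Q m R * X.transpose * J n R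

/-- The polynomial ring `ℂ[V]` in the entries of `X`. -/
abbrev coordRing (n m : ℕ) : Type :=
  MvPolynomial ((Fin n ⊕ Fin n) × (Fin m ⊕ Fin m)) ℂ

/-- The ideal of the scheme-theoretic zero fibre of `X ↦ X Q Xᵗ J`: it is generated by the entries
of this matrix, as polynomials in the entries of the generic matrix `X`. -/
noncomputable def momentIdeal (n m : ℕ) : Ideal (coordRing n m) :=
  Ideal.span (Set.range fun p : (Fin n ⊕ Fin n) × (Fin n ⊕ Fin n) =>
    momentMatrix (Matrix.mvPolynomialX (Fin n ⊕ Fin n) (Fin m ⊕ Fin m) ℂ) p.1 p.2)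

/-- The zero fibre of the moment map is the affine scheme `Spec` of this ring. -/
abbrev zeroFibreRing (n m : ℕ) : Type := coordRing n m ⧸ momentIdeal n m

/-- The closed subscheme of affine space defined by `I` is a complete intersection: `I` can be
generated by as many elements as the codimension says. (The subscheme is then non-empty, since
the dimension of the zero ring is `⊥`.) -/
def IsCompleteIntersection {τ : Type*} [Fintype τ] (I : Ideal (MvPolynomial τ ℂ)) : Prop :=
  ∃ (r : ℕ) (f : Fin r → MvPolynomial τ ℂ), Ideal.span (Set.range f) = I ∧
    ringKrullDim (MvPolynomial τ ℂ ⧸ I) + (r : WithBot ℕ∞) = (Fintype.card τ : WithBot ℕ∞)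

/-- `Spec R` is a normal scheme: all local rings are integrally closed domains. -/
def IsNormalRing (R : Type*) [CommRing R] : Prop :=
  ∀ (p : Ideal R) [p.IsPrime],
    IsDomain (Localization.AtPrime p) ∧ IsIntegrallyClosed (Localization.AtPrime p)

end SpMoment

namespace SpMoment

open MvPolynomial

section LeadingMonomials

variable {σ k : Type*} [Field k]

/-- The polynomials all of whose monomials have weight less than `d`. -/
noncomputable def weightLT (k : Type*) [Field k] (w : σ → ℕ) (d : ℕ) :
    Submodule k (MvPolynomial σ k) :=
  restrictSupport k {e | Finsupp.weight w e < d}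

lemma mem_weightLT {w : σ → ℕ} {d : ℕ} {p : MvPolynomial σ k} :
    p ∈ weightLT k w d ↔ ∀ e ∈ p.support, Finsupp.weight w e < d := by
  simp [weightLT, mem_restrictSupport_iff, Set.subset_def]

lemma weightLT_mono {w : σ → ℕ} {d d' : ℕ} (h : d ≤ d') : weightLT k w d ≤ weightLT k w d' :=
  fun _ hp => mem_weightLT.2 fun e he => (mem_weightLT.1 hp e he).trans_le h

lemma coeff_eq_zero_of_mem_weightLT {w : σ → ℕ} {d : ℕ} {p : MvPolynomial σ k}
    (hp : p ∈ weightLT k w d) {e : σ →₀ ℕ} (he : d ≤ Finsupp.weight w e) : p.coeff e = 0 := by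
  by_contra h
  exact absurd (mem_weightLT.1 hp e (mem_support_iff.2 h)) he.not_gt

lemma mul_mem_weightLT {w : σ → ℕ} {a b : ℕ} {p q : MvPolynomial σ k}
    (hp : p ∈ weightLT k w a) (hq : q ∈ weightLT k w (b + 1)) : p * q ∈ weightLT k w (a + b) := by
  classical
  rw [mem_weightLT] at *
  intro e he
  obtain ⟨e₁, h₁, e₂, h₂, rfl⟩ := Finset.mem_add.1 (support_mul p q he)
  rw [map_add]
  have := hp _ h₁
  have := hq _ h₂
  omega

lemma monomial_mem_weightLT {w : σ → ℕ} {d : ℕ} {e : σ →₀ ℕ} (h : Finsupp.weight w e < d) (c : k) :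
    monomial e c ∈ weightLT k w d :=
  mem_weightLT.2 fun e' he' => by
    have := support_monomial_subset he'
    simp only [Finset.mem_singleton] at this
    rwa [this]

lemma exists_mem_weightLT (w : σ → ℕ) (p : MvPolynomial σ k) : ∃ d, p ∈ weightLT k w d :=
  ⟨p.support.sup (Finsupp.weight w) + 1,
    mem_weightLT.2 fun _ he => Nat.lt_succ_of_le (Finset.le_sup (f := Finsupp.weight w) he)⟩

/-- The part of highest weight of `p` is the monomial `X ^ e`. -/
def HasLeadingMonomial (w : σ → ℕ) (p : MvPolynomial σ k) (e : σ →₀ ℕ) : Prop :=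
  p - monomial e 1 ∈ weightLT k w (Finsupp.weight w e)

namespace HasLeadingMonomial

variable {w : σ → ℕ} {p q : MvPolynomial σ k} {e e' : σ →₀ ℕ}

lemma mem (h : HasLeadingMonomial w p e) : p ∈ weightLT k w (Finsupp.weight w e + 1) := by
  have := add_mem (weightLT_mono (Nat.le_succ _) h)
    (monomial_mem_weightLT (Nat.lt_succ_self (Finsupp.weight w e)) (1 : k))
  simpa using this

lemma monomial (w : σ → ℕ) (e : σ →₀ ℕ) : HasLeadingMonomial w (monomial e (1 : k)) e := by
  simp [HasLeadingMonomial]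

lemma mul (hp : HasLeadingMonomial w p e) (hq : HasLeadingMonomial w q e') :
    HasLeadingMonomial w (p * q) (e + e') := by
  have h : p * q - MvPolynomial.monomial (e + e') 1 =
      (p - MvPolynomial.monomial e 1) * q +
        (q - MvPolynomial.monomial e' 1) * MvPolynomial.monomial e 1 := by
    rw [show MvPolynomial.monomial (e + e') (1 : k) =
      MvPolynomial.monomial e 1 * MvPolynomial.monomial e' 1 by simp [monomial_mul]]
    ring
  rw [HasLeadingMonomial, h, map_add]
  refine add_mem (mul_mem_weightLT hp hq.mem) ?_
  rw [add_comm]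
  exact mul_mem_weightLT hq (monomial_mem_weightLT (Nat.lt_succ_self _) 1)

lemma one : HasLeadingMonomial w (1 : MvPolynomial σ k) 0 :=
  monomial w 0

lemma pow (hp : HasLeadingMonomial w p e) (n : ℕ) : HasLeadingMonomial w (p ^ n) (n • e) := by
  induction n with
  | zero => simpa using one
  | succ n ih => rw [pow_succ, succ_nsmul]; exact ih.mul hp

lemma prod {κ : Type*} {f : κ → MvPolynomial σ k} {d : κ → σ →₀ ℕ} (s : Finset κ)
    (h : ∀ i, HasLeadingMonomial w (f i) (d i)) :
    HasLeadingMonomial w (∏ i ∈ s, f i) (∑ i ∈ s, d i) := by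
  classical
  induction s using Finset.induction_on with
  | empty => simpa using one
  | insert i s hi ih => rw [Finset.prod_insert hi, Finset.sum_insert hi]; exact (h i).mul ih

end HasLeadingMonomial

/-- A linear endomorphism that changes each monomial by terms of lower weight is bijective. -/
lemma bijective_of_hasLeadingMonomial {w : σ → ℕ}
    {L : MvPolynomial σ k →ₗ[k] MvPolynomial σ k}
    (hL : ∀ e, HasLeadingMonomial w (L (monomial e 1)) e) :
    (∀ d, ∀ p ∈ weightLT k w (d + 1), L p - p ∈ weightLT k w d) ∧ Function.Bijective L := by
  have key : ∀ d, ∀ p ∈ weightLT k w (d + 1), L p - p ∈ weightLT k w d := by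
    intro d p hp
    have h : L p - p = ∑ e ∈ p.support, p.coeff e • (L (monomial e 1) - monomial e 1) := by
      conv_lhs => rw [p.as_sum]
      simp only [map_sum, ← Finset.sum_sub_distrib, smul_sub, ← map_smul, smul_eq_mul, mul_one]
    rw [h]
    exact Submodule.sum_mem _ fun e he => Submodule.smul_mem _ _
      (weightLT_mono (Nat.lt_succ_iff.1 (mem_weightLT.1 hp e he)) (hL e))
  refine ⟨key, ?_, ?_⟩
  · rw [← LinearMap.ker_eq_bot, LinearMap.ker_eq_bot']
    intro p hp
    obtain ⟨d, hd⟩ := exists_mem_weightLT w p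
    induction d with
    | zero =>
      refine MvPolynomial.ext _ _ fun e => ?_
      rw [coeff_eq_zero_of_mem_weightLT hd (Nat.zero_le _), coeff_zero]
    | succ d ih =>
      refine ih ?_
      have := key d p hd
      rw [hp, zero_sub] at this
      exact neg_mem_iff.1 this
  · intro p
    obtain ⟨d, hd⟩ := exists_mem_weightLT w p
    induction d generalizing p with
    | zero =>
      refine ⟨0, MvPolynomial.ext _ _ fun e => ?_⟩
      rw [map_zero, coeff_eq_zero_of_mem_weightLT hd (Nat.zero_le _), coeff_zero]
    | succ d ih =>
      obtain ⟨q, hq⟩ := ih _ (key d p hd)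
      exact ⟨p - q, by rw [map_sub, hq]; abel⟩

/-- The exponent of a product of distinct variables. -/
noncomputable def expo (A : Finset σ) : σ →₀ ℕ := Finsupp.indicator A fun _ _ => 1

open Classical in
lemma expo_apply (A : Finset σ) (s : σ) : expo A s = if s ∈ A then 1 else 0 := by
  simp [expo, Finsupp.indicator_apply]

/-- A finite family of polynomials whose leading monomials, with respect to some weight, are
squarefree and pairwise coprime; `A i` is the set of variables of the leading monomial of `f i`. -/
structure CoprimeLeadingFamily (w : σ → ℕ) {κ : Type*} (f : κ → MvPolynomial σ k)
    (A : κ → Finset σ) : Prop where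
  nonempty : ∀ i, (A i).Nonempty
  disjoint : ∀ i j, i ≠ j → Disjoint (A i) (A j)
  leading : ∀ i, HasLeadingMonomial w (f i) (expo (A i))

namespace CoprimeLeadingFamily

variable {w : σ → ℕ} {κ : Type*} {f : κ → MvPolynomial σ k} {A : κ → Finset σ}

/-- The multiplicity of the `i`-th leading monomial in the monomial with exponent `e`. -/
noncomputable def mult (hf : CoprimeLeadingFamily w f A) (e : σ →₀ ℕ) (i : κ) : ℕ :=
  (A i).inf' (hf.nonempty i) e

lemma mult_add_self (hf : CoprimeLeadingFamily w f A) (e : σ →₀ ℕ) (i : κ) :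
    hf.mult (e + expo (A i)) i = hf.mult e i + 1 := by
  have : hf.mult (e + expo (A i)) i = (A i).inf' (hf.nonempty i) (fun s => e s + 1) :=
    Finset.inf'_congr _ rfl fun s hs => by simp [expo_apply, hs]
  rw [this, mult]
  exact (Finset.apply_inf'_eq_inf'_comp (hf.nonempty i) (fun n : ℕ => n + 1)
    (fun a b => by simp [min_add_add_right])).symm

lemma mult_add_of_ne (hf : CoprimeLeadingFamily w f A) (e : σ →₀ ℕ) {i j : κ} (h : i ≠ j) :
    hf.mult (e + expo (A i)) j = hf.mult e j :=
  Finset.inf'_congr _ rfl fun s hs => by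
    simp [expo_apply, Finset.disjoint_right.1 (hf.disjoint i j h) hs]

lemma expo_le_iff (hf : CoprimeLeadingFamily w f A) (e : σ →₀ ℕ) (i : κ) :
    expo (A i) ≤ e ↔ 0 < hf.mult e i := by
  rw [mult, Finset.lt_inf'_iff, Finsupp.le_def]
  simp only [expo_apply]
  refine ⟨fun h s hs => by simpa [hs, Nat.one_le_iff_ne_zero, Nat.pos_iff_ne_zero] using h s,
    fun h s => ?_⟩
  split_ifs with hs
  · exact h s hs
  · exact Nat.zero_le _

open Classical in
lemma mult_add (hf : CoprimeLeadingFamily w f A) (e : σ →₀ ℕ) (i j : κ) :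
    hf.mult (e + expo (A i)) j = hf.mult e j + if i = j then 1 else 0 := by
  split_ifs with h
  · subst h; exact hf.mult_add_self e i
  · rw [hf.mult_add_of_ne e h, add_zero]

/-- The ideal generated by some of the leading monomials. -/
noncomputable def leadIdeal (A : κ → Finset σ) (k : Type*) [Field k] (K : Set κ) :
    Ideal (MvPolynomial σ k) :=
  Ideal.span ((fun e => monomial e (1 : k)) '' ((fun i => expo (A i)) '' K))

lemma mem_leadIdeal {K : Set κ} {p : MvPolynomial σ k} :
    p ∈ leadIdeal A k K ↔ ∀ e ∈ p.support, ∃ i ∈ K, expo (A i) ≤ e := by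
  rw [leadIdeal, mem_ideal_span_monomial_image]
  simp

variable [Fintype κ]

lemma sum_mult_le (hf : CoprimeLeadingFamily w f A) (e : σ →₀ ℕ) :
    ∑ i, hf.mult e i • expo (A i) ≤ e := by
  classical
  intro s
  simp only [Finsupp.coe_finsetSum, Finset.sum_apply, Finsupp.smul_apply, expo_apply, smul_eq_mul,
    mul_ite, mul_one, mul_zero]
  by_cases h : ∃ i, s ∈ A i
  · obtain ⟨i, hi⟩ := h
    rw [Finset.sum_eq_single i]
    · rw [if_pos hi]
      exact Finset.inf'_le _ hi
    · intro j _ hj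
      rw [if_neg (Finset.disjoint_left.1 (hf.disjoint i j hj.symm) hi)]
    · simp
  · push Not at h
    simp [h]

/-- The part of the exponent `e` that is left when the leading monomials are removed. -/
noncomputable def rest (hf : CoprimeLeadingFamily w f A) (e : σ →₀ ℕ) : σ →₀ ℕ :=
  e - ∑ i, hf.mult e i • expo (A i)

lemma sum_mult_add_rest (hf : CoprimeLeadingFamily w f A) (e : σ →₀ ℕ) :
    ∑ i, hf.mult e i • expo (A i) + hf.rest e = e :=
  add_tsub_cancel_of_le (hf.sum_mult_le e)

lemma rest_add (hf : CoprimeLeadingFamily w f A) (e : σ →₀ ℕ) (i : κ) :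
    hf.rest (e + expo (A i)) = hf.rest e := by
  classical
  rw [rest, rest]
  simp only [mult_add, add_smul, Finset.sum_add_distrib, ite_smul, one_smul, zero_smul,
    Finset.sum_ite_eq, Finset.mem_univ, if_true]
  exact add_tsub_add_eq_tsub_right _ _ _

/-- The linear map that replaces each leading monomial by the corresponding polynomial. -/
noncomputable def straighten (hf : CoprimeLeadingFamily w f A) :
    MvPolynomial σ k →ₗ[k] MvPolynomial σ k :=
  (basisMonomials σ k).constr k fun e => (∏ i, f i ^ hf.mult e i) * monomial (hf.rest e) 1

lemma straighten_monomial (hf : CoprimeLeadingFamily w f A) (e : σ →₀ ℕ) :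
    hf.straighten (monomial e 1) = (∏ i, f i ^ hf.mult e i) * monomial (hf.rest e) 1 := by
  have := (basisMonomials σ k).constr_basis k
    (fun e => (∏ i, f i ^ hf.mult e i) * monomial (hf.rest e) (1 : k)) e
  simpa [straighten] using this

lemma straighten_leading (hf : CoprimeLeadingFamily w f A) (e : σ →₀ ℕ) :
    HasLeadingMonomial w (hf.straighten (monomial e 1)) e := by
  rw [straighten_monomial]
  have := (HasLeadingMonomial.prod Finset.univ
    fun i => (hf.leading i).pow (hf.mult e i)).mul (.monomial w (hf.rest e))
  exact (congrArg _ (hf.sum_mult_add_rest e)).mp this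

lemma straighten_bijective (hf : CoprimeLeadingFamily w f A) : Function.Bijective hf.straighten :=
  (bijective_of_hasLeadingMonomial hf.straighten_leading).2

lemma straighten_mul (hf : CoprimeLeadingFamily w f A) (i : κ) (p : MvPolynomial σ k) :
    hf.straighten (monomial (expo (A i)) 1 * p) = f i * hf.straighten p := by
  classical
  suffices hf.straighten ∘ₗ LinearMap.mulLeft k (monomial (expo (A i)) 1) =
      LinearMap.mulLeft k (f i) ∘ₗ hf.straighten from LinearMap.congr_fun this p
  refine (basisMonomials σ k).ext fun e => ?_
  simp only [coe_basisMonomials, LinearMap.comp_apply, LinearMap.mulLeft_apply, monomial_mul,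
    mul_one]
  rw [add_comm, straighten_monomial, straighten_monomial, rest_add]
  simp only [mult_add, pow_add, Finset.prod_mul_distrib, pow_ite, pow_one, pow_zero,
    Finset.prod_ite_eq, Finset.mem_univ, if_true]
  ring

lemma straighten_mem_iff (hf : CoprimeLeadingFamily w f A) (K : Set κ) (p : MvPolynomial σ k) :
    hf.straighten p ∈ Ideal.span (f '' K) ↔ p ∈ leadIdeal A k K := by
  constructor
  · suffices ∀ q ∈ Ideal.span (f '' K), ∃ p ∈ leadIdeal A k K, hf.straighten p = q by
      intro h
      obtain ⟨p', hp', h'⟩ := this _ h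
      rwa [← hf.straighten_bijective.1 h']
    intro q hq
    induction hq using Submodule.closure_induction with
    | zero => exact ⟨0, zero_mem _, map_zero _⟩
    | add x y _ _ hx hy =>
      obtain ⟨a, ha, rfl⟩ := hx
      obtain ⟨b, hb, rfl⟩ := hy
      exact ⟨a + b, add_mem ha hb, map_add _ _ _⟩
    | smul_mem r x hx =>
      obtain ⟨i, hi, rfl⟩ := hx
      obtain ⟨a, rfl⟩ := hf.straighten_bijective.2 r
      refine ⟨monomial (expo (A i)) 1 * a, Ideal.mul_mem_right _ _
        (Ideal.subset_span ⟨_, ⟨i, hi, rfl⟩, rfl⟩), ?_⟩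
      rw [straighten_mul, smul_eq_mul, mul_comm]
  · intro hp
    rw [leadIdeal, Set.image_image] at hp
    induction hp using Submodule.closure_induction with
    | zero => simp
    | add x y _ _ hx hy => rw [map_add]; exact add_mem hx hy
    | smul_mem r x hx =>
      obtain ⟨i, hi, rfl⟩ := hx
      rw [smul_eq_mul, mul_comm]
      simp only [straighten_mul]
      exact Ideal.mul_mem_right _ _ (Ideal.subset_span ⟨i, hi, rfl⟩)

/-- Each member of the family is a nonzerodivisor modulo any set of other members. -/
theorem mem_span_of_mul_mem (hf : CoprimeLeadingFamily w f A) {K : Set κ} {i : κ} (hi : i ∉ K)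
    {q : MvPolynomial σ k} (hq : f i * q ∈ Ideal.span (f '' K)) : q ∈ Ideal.span (f '' K) := by
  obtain ⟨p, rfl⟩ := hf.straighten_bijective.2 q
  rw [← straighten_mul, straighten_mem_iff, mem_leadIdeal] at hq
  rw [straighten_mem_iff, mem_leadIdeal]
  intro e he
  obtain ⟨j, hj, h⟩ := hq (expo (A i) + e) (by
    rw [mem_support_iff, coeff_monomial_mul, one_mul]
    exact mem_support_iff.1 he)
  refine ⟨j, hj, ?_⟩
  rw [hf.expo_le_iff, add_comm, hf.mult_add_of_ne e (ne_of_mem_of_not_mem hj hi).symm] at h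
  exact (hf.expo_le_iff e j).2 h

end CoprimeLeadingFamily

/-- The algebra endomorphism of a polynomial ring that sends the variables in `K` to `0`. -/
noncomputable def killVars (k : Type*) [Field k] (K : Set σ) :
    MvPolynomial σ k →ₐ[k] MvPolynomial σ k :=
  open Classical in aeval fun s => if s ∈ K then 0 else X s

lemma killVars_X_of_mem {K : Set σ} {s : σ} (h : s ∈ K) : killVars k K (X s) = 0 := by
  simp [killVars, h]

lemma killVars_X_of_notMem {K : Set σ} {s : σ} (h : s ∉ K) : killVars k K (X s) = X s := by
  simp [killVars, h]

lemma coeff_killVars {K : Set σ} {e : σ →₀ ℕ} (he : ∀ s ∈ K, e s = 0) (p : MvPolynomial σ k) :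
    coeff e (killVars k K p) = coeff e p := by
  classical
  induction p using MvPolynomial.induction_on' with
  | add p q hp hq => simp [hp, hq]
  | monomial e' a =>
    by_cases h : ∀ s ∈ K, e' s = 0
    · congr 1
      rw [monomial_eq, map_mul, Finsupp.prod, map_prod, algHom_C]
      congr 1
      refine Finset.prod_congr rfl fun s hs => ?_
      rw [map_pow, killVars_X_of_notMem fun hK => Finsupp.mem_support_iff.1 hs (h s hK)]
    · push Not at h
      obtain ⟨s, hs, hs'⟩ := h
      rw [coeff_monomial, if_neg (by rintro rfl; exact hs' (he s hs)), monomial_eq, map_mul,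
        Finsupp.prod, map_prod, Finset.prod_eq_zero (Finsupp.mem_support_iff.2 hs'), mul_zero,
        coeff_zero]
      rw [map_pow, killVars_X_of_mem hs, zero_pow hs']

instance (K : Set σ) : (RingHom.ker (killVars k K)).IsPrime := RingHom.ker_isPrime _

/-- The monomial prime spanned by the variables in `K` has height at least `#K`. -/
lemma card_le_height_ker_killVars (K : Finset σ) :
    (K.card : ℕ∞) ≤ (RingHom.ker (killVars k (K : Set σ))).height := by
  classical
  induction K using Finset.induction_on with
  | empty => simp
  | insert s K hs ih =>
    have hlt : RingHom.ker (killVars k (K : Set σ)) <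
        RingHom.ker (killVars k ((insert s K : Finset σ) : Set σ)) := by
      refine lt_of_le_of_ne (fun p hp => ?_) fun h => ?_
      · have : killVars k ((insert s K : Finset σ) : Set σ) =
            (killVars k ((insert s K : Finset σ) : Set σ)).comp (killVars k (K : Set σ)) := by
          refine MvPolynomial.algHom_ext fun t => ?_
          by_cases ht : t ∈ (K : Set σ)
          · rw [AlgHom.comp_apply, killVars_X_of_mem ht, killVars_X_of_mem (by simp_all), map_zero]
          · rw [AlgHom.comp_apply, killVars_X_of_notMem ht]
        rw [RingHom.mem_ker] at hp ⊢
        rw [this, AlgHom.comp_apply, hp, map_zero]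
      · have h1 : X s ∈ RingHom.ker (killVars k ((insert s K : Finset σ) : Set σ)) :=
          killVars_X_of_mem (by simp)
        rw [← h, RingHom.mem_ker, killVars_X_of_notMem (by simpa using hs)] at h1
        exact X_ne_zero _ h1
    rw [Finset.card_insert_of_notMem hs]
    rw [Nat.cast_add, Nat.cast_one]
    exact (add_le_add_left ih 1).trans (Ideal.height_add_one_le_of_lt_of_isPrime hlt)

namespace CoprimeLeadingFamily

variable {w : σ → ℕ} {κ : Type*} {f : κ → MvPolynomial σ k} {A : κ → Finset σ}

lemma leadIdeal_isRadical : (leadIdeal A k (Set.univ : Set κ)).IsRadical := by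
  rintro p ⟨n, hp⟩
  rw [mem_leadIdeal]
  intro e he
  by_contra! h
  have h' : ∀ i, ∃ s ∈ A i, e s = 0 := by
    intro i
    have := h i trivial
    contrapose! this
    intro s
    rw [expo_apply]
    split_ifs with hs
    · exact Nat.one_le_iff_ne_zero.2 (this s hs)
    · exact Nat.zero_le _
  choose c hc hc' using h'
  have hle : leadIdeal A k (Set.univ : Set κ) ≤ RingHom.ker (killVars k (Set.range c)) := by
    rw [leadIdeal, Ideal.span_le]
    rintro _ ⟨_, ⟨i, -, rfl⟩, rfl⟩
    rw [SetLike.mem_coe, RingHom.mem_ker]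
    beta_reduce
    rw [monomial_eq, map_mul, Finsupp.prod, map_prod, Finset.prod_eq_zero (i := c i), mul_zero]
    · simp [expo_apply, hc]
    · rw [map_pow, killVars_X_of_mem (Set.mem_range_self i), zero_pow]
      simp [expo_apply, hc]
  have h2 : p ∈ RingHom.ker (killVars k (Set.range c)) :=
    Ideal.IsPrime.mem_of_pow_mem inferInstance n (hle hp)
  have h3 := coeff_killVars (k := k) (K := Set.range c) (e := e)
    (by rintro _ ⟨i, rfl⟩; exact hc' i) p
  rw [RingHom.mem_ker.1 h2, coeff_zero] at h3
  exact mem_support_iff.1 he h3.symm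

end CoprimeLeadingFamily

lemma pow_mem_weightLT {w : σ → ℕ} {d : ℕ} {p : MvPolynomial σ k} (hp : p ∈ weightLT k w (d + 1))
    (n : ℕ) : p ^ n ∈ weightLT k w (n * d + 1) := by
  induction n with
  | zero =>
    have := (HasLeadingMonomial.one (k := k) (w := w)).mem
    simpa using this
  | succ n ih =>
    rw [pow_succ, show (n + 1) * d + 1 = n * d + 1 + d by ring]
    exact mul_mem_weightLT ih hp

lemma pow_sub_pow_mem_weightLT {w : σ → ℕ} {d : ℕ} {p q : MvPolynomial σ k}
    (hp : p ∈ weightLT k w (d + 1)) (hq : q ∈ weightLT k w (d + 1))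
    (h : p - q ∈ weightLT k w d) (n : ℕ) : p ^ n - q ^ n ∈ weightLT k w (n * d) := by
  induction n with
  | zero => simp
  | succ n ih =>
    rw [show p ^ (n + 1) - q ^ (n + 1) = (p ^ n - q ^ n) * p + (p - q) * q ^ n by ring,
      show (n + 1) * d = n * d + d by ring]
    refine add_mem (mul_mem_weightLT ih hp) ?_
    rw [add_comm (n * d)]
    exact mul_mem_weightLT h (pow_mem_weightLT hq n)

lemma weightedHomogeneousComponent_mem_weightLT (w : σ → ℕ) (d : ℕ) (p : MvPolynomial σ k) :
    weightedHomogeneousComponent w d p ∈ weightLT k w (d + 1) := by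
  classical
  rw [mem_weightLT]
  intro e he
  rw [mem_support_iff, coeff_weightedHomogeneousComponent] at he
  have : Finsupp.weight w e = d := by by_contra h; simp [h] at he
  omega

lemma sub_weightedHomogeneousComponent_mem_weightLT {w : σ → ℕ} {d : ℕ} {p : MvPolynomial σ k}
    (hp : p ∈ weightLT k w (d + 1)) :
    p - weightedHomogeneousComponent w d p ∈ weightLT k w d := by
  classical
  rw [mem_weightLT]
  intro e he
  rw [mem_support_iff, coeff_sub, coeff_weightedHomogeneousComponent] at he
  have h1 : Finsupp.weight w e ≠ d := by rintro h; simp [h] at he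
  rw [if_neg h1, sub_zero] at he
  have := mem_weightLT.1 hp e (mem_support_iff.2 he)
  omega

namespace CoprimeLeadingFamily

variable {w : σ → ℕ} {κ : Type*} {f : κ → MvPolynomial σ k} {A : κ → Finset σ} [Fintype κ]

lemma straighten_sub_mem (hf : CoprimeLeadingFamily w f A) {d : ℕ} {p : MvPolynomial σ k}
    (hp : p ∈ weightLT k w (d + 1)) : hf.straighten p - p ∈ weightLT k w d :=
  (bijective_of_hasLeadingMonomial hf.straighten_leading).1 d p hp

lemma mem_weightLT_of_straighten_mem (hf : CoprimeLeadingFamily w f A) {d : ℕ}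
    {p : MvPolynomial σ k} (hp : hf.straighten p ∈ weightLT k w d) : p ∈ weightLT k w d := by
  suffices ∀ n, p ∈ weightLT k w (d + n) → p ∈ weightLT k w d by
    obtain ⟨n, hn⟩ := exists_mem_weightLT w p
    exact this n (weightLT_mono (Nat.le_add_left _ _) hn)
  intro n
  induction n with
  | zero => exact id
  | succ n ih =>
    intro h
    refine ih ?_
    have := sub_mem (weightLT_mono (Nat.le_add_right d n) hp) (hf.straighten_sub_mem h)
    simpa using this

/-- The ideal generated by the family is radical. -/
theorem isRadical_span (hf : CoprimeLeadingFamily w f A) :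
    (Ideal.span (Set.range f)).IsRadical := by
  classical
  rintro g ⟨n, hg⟩
  rw [← Set.image_univ] at hg ⊢
  obtain ⟨d, hd⟩ := exists_mem_weightLT w g
  induction d generalizing g with
  | zero =>
    have : g = 0 := MvPolynomial.ext _ _ fun e => by
      rw [coeff_eq_zero_of_mem_weightLT hd (Nat.zero_le _), coeff_zero]
    rw [this]
    exact zero_mem _
  | succ d ih =>
    set t := weightedHomogeneousComponent w d g with ht
    have ht₁ : t ∈ weightLT k w (d + 1) := weightedHomogeneousComponent_mem_weightLT w d g
    have ht₂ : g - t ∈ weightLT k w d := sub_weightedHomogeneousComponent_mem_weightLT hd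
    obtain ⟨h, hh⟩ := hf.straighten_bijective.2 (g ^ n)
    have hI : h ∈ leadIdeal A k Set.univ := by
      rw [← hf.straighten_mem_iff, hh]
      exact hg
    have hh₁ : h ∈ weightLT k w (n * d + 1) :=
      hf.mem_weightLT_of_straighten_mem (hh ▸ pow_mem_weightLT hd n)
    have hdiff : t ^ n - h ∈ weightLT k w (n * d) := by
      have h1 := hf.straighten_sub_mem hh₁
      have h2 := pow_sub_pow_mem_weightLT hd ht₁ ht₂ n
      rw [hh] at h1
      have := sub_mem h1 h2
      rwa [sub_sub_sub_cancel_left] at this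
    have hhom : IsWeightedHomogeneous w (t ^ n) (n * d) := by
      have := (weightedHomogeneousComponent_isWeightedHomogeneous (w := w) d g).pow n
      simpa using this
    have htI : t ∈ leadIdeal A k Set.univ := by
      refine leadIdeal_isRadical ⟨n, ?_⟩
      rw [mem_leadIdeal] at hI ⊢
      intro e he
      refine hI e ?_
      rw [mem_support_iff] at he ⊢
      have h0 := coeff_eq_zero_of_mem_weightLT hdiff (hhom he).ge
      rw [coeff_sub, sub_eq_zero] at h0
      rwa [← h0]
    have hLt : hf.straighten t ∈ Ideal.span (f '' Set.univ) := (hf.straighten_mem_iff _ _).2 htI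
    have hrec := ih (g := g - hf.straighten t) ?_ ?_
    · simpa using add_mem hrec hLt
    · have := Ideal.mem_of_dvd (Ideal.span (f '' Set.univ))
        (sub_dvd_pow_sub_pow (g - hf.straighten t) g n)
        (by simpa using neg_mem hLt)
      simpa using add_mem this hg
    · have := sub_mem ht₂ (hf.straighten_sub_mem ht₁)
      rwa [sub_sub_sub_cancel_right] at this

variable [Fintype σ]

/-- The family cuts out a subscheme of codimension equal to its cardinality. -/
theorem ringKrullDim_quotient_span (hf : CoprimeLeadingFamily w f A)
    (h₀ : ∀ i, constantCoeff (f i) = 0) :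
    ringKrullDim (MvPolynomial σ k ⧸ Ideal.span (Set.range f)) + (Fintype.card κ : WithBot ℕ∞) =
      (Fintype.card σ : WithBot ℕ∞) := by
  classical
  refine le_antisymm ?_ ?_
  · suffices ∀ K : Finset κ, ringKrullDim (MvPolynomial σ k ⧸ Ideal.span (f '' (K : Set κ))) +
        (K.card : WithBot ℕ∞) ≤ (Fintype.card σ : WithBot ℕ∞) by
      have := this Finset.univ
      rwa [Finset.coe_univ, Set.image_univ, Finset.card_univ] at this
    intro K
    induction K using Finset.induction_on with
    | empty =>
      have h1 : ringKrullDim (MvPolynomial σ k) = (Fintype.card σ : WithBot ℕ∞) := by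
        rw [MvPolynomial.ringKrullDim_of_isNoetherianRing, ringKrullDim_eq_zero_of_field, zero_add,
          Nat.card_eq_fintype_card]
      rw [Finset.card_empty, Nat.cast_zero, add_zero, ← h1]
      exact ringKrullDim_quotient_le _
    | insert i K hi ih =>
      have hle : Ideal.span (f '' (K : Set κ)) ≤
          Ideal.span (f '' ((insert i K : Finset κ) : Set κ)) :=
        Ideal.span_mono (Set.image_mono (by simp))
      have := ringKrullDim_succ_le_of_surjective (Ideal.Quotient.factor hle)
        (Ideal.Quotient.factor_surjective hle)
        (r := Ideal.Quotient.mk _ (f i)) ?_ ?_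
      · rw [Finset.card_insert_of_notMem hi, Nat.cast_add, Nat.cast_one,
          add_comm (K.card : WithBot ℕ∞), ← add_assoc]
        exact (add_le_add_left this _).trans ih
      · rw [mem_nonZeroDivisors_iff_right]
        intro x hx
        obtain ⟨q, rfl⟩ := Ideal.Quotient.mk_surjective x
        rw [← map_mul, Ideal.Quotient.eq_zero_iff_mem, mul_comm] at hx
        exact Ideal.Quotient.eq_zero_iff_mem.2 (hf.mem_span_of_mul_mem (by simpa using hi) hx)
      · rw [Ideal.Quotient.factor_mk, Ideal.Quotient.eq_zero_iff_mem]
        exact Ideal.subset_span ⟨i, by simp, rfl⟩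
  · have hP : Set.range f ⊆ RingHom.ker (killVars k ((Finset.univ : Finset σ) : Set σ)) := by
      rintro _ ⟨i, rfl⟩
      have : (killVars k ((Finset.univ : Finset σ) : Set σ)) =
          (Algebra.ofId k (MvPolynomial σ k)).comp (aeval fun _ => (0 : k)) := by
        refine MvPolynomial.algHom_ext fun s => ?_
        rw [killVars_X_of_mem (by simp)]
        simp
      rw [SetLike.mem_coe, RingHom.mem_ker, this, AlgHom.comp_apply]
      rw [aeval_zero', h₀, map_zero, map_zero]
    have h1 := Ideal.height_le_ringKrullDim_quotient_add_encard _ hP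
    have h2 := card_le_height_ker_killVars (k := k) (Finset.univ : Finset σ)
    rw [Finset.card_univ] at h2
    refine ((WithBot.coe_le_coe.2 h2).trans h1).trans ?_
    gcongr
    have h3 : (Set.range f).encard ≤ (Fintype.card κ : ℕ∞) := by
      rw [← Set.image_univ]
      refine (Set.encard_image_le _ _).trans ?_
      simp
    exact_mod_cast h3

end CoprimeLeadingFamily

end LeadingMonomials

section GramIdeal

variable {ι α : Type*} [Fintype α]

/-- The symmetric bilinear form with matrix `Q`. -/
def hyperbolic {T : Type*} [CommRing T] (x y : α ⊕ α → T) : T :=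
  ∑ a, (x (.inl a) * y (.inr a) + x (.inr a) * y (.inl a))

variable (ι α) in
/-- The ideal of the scheme of families of vectors that span a totally isotropic subspace of the
hyperbolic quadratic space. -/
noncomputable def gramIdeal (k : Type*) [Field k] : Ideal (MvPolynomial (ι × (α ⊕ α)) k) :=
  Ideal.span (Set.range fun p : ι × ι => hyperbolic (fun c => X (p.1, c)) fun c => X (p.2, c))

variable {k : Type*} [Field k]

lemma weight_expo_pair {σ : Type*} [DecidableEq σ] (w : σ → ℕ) {s t : σ} (h : s ≠ t) :
    Finsupp.weight w (expo {s, t}) = w s + w t := by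
  have : expo {s, t} = Finsupp.single s 1 + Finsupp.single t 1 := by
    ext r
    simp only [expo_apply, Finset.mem_insert, Finset.mem_singleton, Finsupp.add_apply,
      Finsupp.single_apply]
    grind
  rw [this, map_add, Finsupp.weight_single, Finsupp.weight_single]
  simp

lemma monomial_expo_pair {σ : Type*} [DecidableEq σ] {s t : σ} (h : s ≠ t) :
    monomial (expo {s, t}) (1 : k) = X s * X t := by
  have : expo {s, t} = Finsupp.single s 1 + Finsupp.single t 1 := by
    ext r
    simp only [expo_apply, Finset.mem_insert, Finset.mem_singleton, Finsupp.add_apply,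
      Finsupp.single_apply]
    grind
  rw [this, X, X, monomial_mul, one_mul]

lemma hasLeadingMonomial_X {σ : Type*} (w : σ → ℕ) (s : σ) :
    HasLeadingMonomial w (X s : MvPolynomial σ k) (expo {s}) := by
  classical
  have : expo {s} = Finsupp.single s 1 := by
    ext r
    simp only [expo_apply, Finset.mem_singleton, Finsupp.single_apply]
    grind
  rw [this]
  exact .monomial w _

lemma X_mul_X_mem_weightLT {σ : Type*} {w : σ → ℕ} {s t : σ} {d : ℕ} (h : w s + w t < d) :
    (X s * X t : MvPolynomial σ k) ∈ weightLT k w d := by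
  rw [X, X, monomial_mul]
  refine monomial_mem_weightLT ?_ _
  rw [map_add, Finsupp.weight_single, Finsupp.weight_single]
  simpa using h

/-- An integral weight on finitely many variables can be shifted to a nonnegative one. -/
lemma exists_shifted_weight {σ : Type*} [Finite σ] (z : σ → ℤ) :
    ∃ (w : σ → ℕ) (C : ℤ), ∀ s, (w s : ℤ) = z s + C := by
  cases nonempty_fintype σ
  refine ⟨fun s => (z s + ∑ t, |z t|).toNat, ∑ t, |z t|, fun s => Int.toNat_of_nonneg ?_⟩
  have h1 := Finset.single_le_sum (f := fun t => |z t|) (fun t _ => abs_nonneg (z t))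
    (Finset.mem_univ s)
  have h2 := neg_abs_le (z s)
  linarith

open Classical in
/-- The generators of the ideal of the isotropic scheme, with a factor `2` removed on the
diagonal. -/
noncomputable def halfGram (k : Type*) [Field k] (i j : ι) : MvPolynomial (ι × (α ⊕ α)) k :=
  ∑ a, X (i, .inl a) * X (j, .inr a) + if i = j then 0 else ∑ a, X (i, .inr a) * X (j, .inl a)

lemma constantCoeff_halfGram (i j : ι) : constantCoeff (halfGram (α := α) k i j) = 0 := by
  classical
  simp only [halfGram]
  split_ifs <;> simp

/-- The integral weight for which the leading monomial of `halfGram i j` uses the column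
`ρ j - ρ i`. -/
def gramWeight (ρ : ι → ℕ) (γ : α → ℕ) : ι × (α ⊕ α) → ℤ
  | (i, .inl a) => -((ρ i : ℤ) + γ a) ^ 2
  | (i, .inr a) => -(ρ i : ℤ) ^ 2 + 2 * γ a * ρ i

open Classical in
theorem exists_coprimeLeadingFamily [Finite ι] {ρ : ι → ℕ} {γ : α → ℕ}
    (hρ : ρ.Injective) (hγ : γ.Injective)
    {c : ι → ι → α} (hc : ∀ i j, ρ i ≤ ρ j → γ (c i j) = ρ j - ρ i)
    {ε : Type*} {v : ε → ι × (α ⊕ α)} (hv : v.Injective)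
    (hvc : ∀ e i j, ρ i ≤ ρ j → (v e).2 ≠ .inl (c i j) ∧ (v e).2 ≠ .inr (c i j)) :
    ∃ w : ι × (α ⊕ α) → ℕ, CoprimeLeadingFamily w
      (Sum.elim (fun p : {p : ι × ι // ρ p.1 ≤ ρ p.2} => halfGram k p.1.1 p.1.2) fun e => X (v e))
      (Sum.elim (fun p => {(p.1.1, .inl (c p.1.1 p.1.2)), (p.1.2, .inr (c p.1.1 p.1.2))})
        fun e => {v e}) := by
  obtain ⟨w, C, hw⟩ := exists_shifted_weight (gramWeight (ι := ι) ρ γ)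
  refine ⟨w, ?_, ?_, ?_⟩
  · rintro (p | e) <;> simp
  · have key : ∀ p q : {p : ι × ι // ρ p.1 ≤ ρ p.2},
        (p.1.1 = q.1.1 ∨ p.1.2 = q.1.2) → c p.1.1 p.1.2 = c q.1.1 q.1.2 → p = q := by
      rintro ⟨⟨i, j⟩, hp⟩ ⟨⟨i', j'⟩, hq⟩ h h'
      simp only at hp hq h h'
      have h1 := hc i j hp
      rw [h', hc i' j' hq] at h1
      rcases h with rfl | rfl
      · obtain rfl : j = j' := hρ (by omega)
        rfl
      · obtain rfl : i = i' := hρ (by omega)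
        rfl
    rintro (p | e) (q | e') hne
    · have hne' : p ≠ q := fun h => hne (by rw [h])
      simp only [Sum.elim_inl, Finset.disjoint_insert_left, Finset.disjoint_singleton_left,
        Finset.mem_insert, Finset.mem_singleton, Prod.mk.injEq, Sum.inl.injEq, Sum.inr.injEq,
        reduceCtorEq, and_false, or_false, false_or, not_and]
      exact ⟨fun h h' => hne' (key p q (.inl h) h'), fun h h' => hne' (key p q (.inr h) h')⟩
    · have := hvc e' p.1.1 p.1.2 p.2
      simp only [Sum.elim_inl, Sum.elim_inr, Finset.disjoint_singleton_right, Finset.mem_insert,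
        Finset.mem_singleton, not_or]
      exact ⟨fun h => this.1 (by rw [h]), fun h => this.2 (by rw [h])⟩
    · have := hvc e q.1.1 q.1.2 q.2
      simp only [Sum.elim_inl, Sum.elim_inr, Finset.disjoint_singleton_left, Finset.mem_insert,
        Finset.mem_singleton, not_or]
      exact ⟨fun h => this.1 (by rw [h]), fun h => this.2 (by rw [h])⟩
    · simp only [Sum.elim_inr, Finset.disjoint_singleton_left, Finset.mem_singleton]
      exact fun h => hne (by rw [hv h])
  · rintro (⟨⟨i, j⟩, hij⟩ | e)
    · simp only [Sum.elim_inl] at hij ⊢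
      have hcij : (γ (c i j) : ℤ) = ρ j - ρ i := by rw [hc i j hij, Nat.cast_sub hij]
      have hst : ((i, .inl (c i j)) : ι × (α ⊕ α)) ≠ (j, .inr (c i j)) := by simp
      rw [HasLeadingMonomial, weight_expo_pair w hst, monomial_expo_pair hst, halfGram,
        ← Finset.add_sum_erase _ _ (Finset.mem_univ (c i j)), add_assoc, add_sub_cancel_left]
      refine add_mem (Submodule.sum_mem _ fun a ha => X_mul_X_mem_weightLT ?_) ?_
      · have hne : (γ a : ℤ) - γ (c i j) ≠ 0 :=
          sub_ne_zero.2 (by exact_mod_cast hγ.ne (Finset.ne_of_mem_erase ha))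
        zify
        simp only [hw, gramWeight]
        have := sq_pos_of_ne_zero hne
        rw [hcij] at this ⊢
        nlinarith
      · split_ifs with h
        · exact zero_mem _
        · refine Submodule.sum_mem _ fun a _ => X_mul_X_mem_weightLT ?_
          have hlt : (ρ i : ℤ) < ρ j := by exact_mod_cast lt_of_le_of_ne hij (hρ.ne h)
          zify
          simp only [hw, gramWeight]
          rw [hcij]
          have hpos : 0 < ((γ a : ℤ) + (ρ j - ρ i)) := by
            have : (0 : ℤ) ≤ γ a := Int.natCast_nonneg _
            linarith
          have := sq_pos_of_pos hpos
          nlinarith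
    · exact hasLeadingMonomial_X w _

lemma hyperbolic_X_eq (i j : ι) [DecidableEq ι] :
    hyperbolic (fun c : α ⊕ α => (X (i, c) : MvPolynomial (ι × (α ⊕ α)) k)) (fun c => X (j, c)) =
      (if i = j then 2 else 1) * halfGram k i j := by
  classical
  rw [hyperbolic, Finset.sum_add_distrib, halfGram]
  split_ifs with h
  · subst h
    rw [add_zero, two_mul]
    congr 1
    exact Finset.sum_congr rfl fun a _ => mul_comm _ _
  · rw [one_mul]

lemma halfGram_comm (i j : ι) : halfGram (α := α) k i j = halfGram k j i := by
  classical
  simp only [halfGram]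
  by_cases h : i = j
  · rw [h]
  · rw [if_neg h, if_neg (Ne.symm h), add_comm]
    congr 1 <;> exact Finset.sum_congr rfl fun a _ => mul_comm _ _

lemma span_halfGram [NeZero (2 : k)] (ρ : ι → ℕ) :
    Ideal.span (Set.range fun p : {p : ι × ι // ρ p.1 ≤ ρ p.2} => halfGram k p.1.1 p.1.2) =
      gramIdeal ι α k := by
  classical
  refine le_antisymm ?_ ?_
  · rw [Ideal.span_le]
    rintro _ ⟨⟨⟨i, j⟩, h⟩, rfl⟩
    have h2 : C (2⁻¹) * (2 : MvPolynomial (ι × (α ⊕ α)) k) = 1 := by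
      rw [← map_ofNat C 2, ← C_mul, inv_mul_cancel₀ (NeZero.ne (2 : k)), C_1]
    have h1 : hyperbolic (fun c : α ⊕ α => (X (i, c) : MvPolynomial (ι × (α ⊕ α)) k))
        (fun c => X (j, c)) ∈ gramIdeal ι α k := Ideal.subset_span ⟨(i, j), rfl⟩
    rw [hyperbolic_X_eq] at h1
    split_ifs at h1 with hij
    · have h3 := Ideal.mul_mem_left _ (C (2⁻¹)) h1
      rwa [← mul_assoc, h2, one_mul] at h3
    · rwa [one_mul] at h1
  · rw [gramIdeal, Ideal.span_le]
    rintro _ ⟨⟨i, j⟩, rfl⟩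
    simp only [hyperbolic_X_eq]
    refine Ideal.mul_mem_left _ _ ?_
    rcases le_total (ρ i) (ρ j) with h | h
    · exact Ideal.subset_span ⟨⟨(i, j), h⟩, rfl⟩
    · rw [halfGram_comm]
      exact Ideal.subset_span ⟨⟨(j, i), h⟩, rfl⟩

lemma two_mul_card_ordered_pairs [Fintype ι] {ρ : ι → ℕ} (hρ : ρ.Injective) :
    2 * Fintype.card {p : ι × ι // ρ p.1 ≤ ρ p.2} = Fintype.card ι ^ 2 + Fintype.card ι := by
  classical
  let s : Finset (ι × ι) := Finset.univ.filter fun p => ρ p.1 ≤ ρ p.2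
  let t : Finset (ι × ι) := Finset.univ.filter fun p => ρ p.2 ≤ ρ p.1
  have hst : s.card = t.card :=
    Finset.card_bij' (fun p _ => p.swap) (fun p _ => p.swap) (by simp [s, t]) (by simp [s, t])
      (by simp) (by simp)
  have h1 := Finset.card_union_add_card_inter s t
  have h2 : s ∪ t = Finset.univ := by
    ext p; simpa [s, t] using le_total _ _
  have h3 : s ∩ t = Finset.univ.diag := by
    ext ⟨i, j⟩
    simp only [s, t, Finset.mem_inter, Finset.mem_filter, Finset.mem_univ, true_and,
      Finset.mem_diag]
    exact ⟨fun h => hρ (le_antisymm h.1 h.2), fun h => by simp [h]⟩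
  rw [h2, h3, Finset.diag_card, Finset.card_univ, Finset.card_univ, Fintype.card_prod, ← hst] at h1
  rw [Fintype.card_subtype]
  change 2 * s.card = _
  rw [two_mul, ← h1, sq]

lemma exists_row_and_column_labels [Fintype ι] (h : Fintype.card ι ≤ Fintype.card α) :
    ∃ (ρ : ι → ℕ) (γ : α → ℕ) (c : ι → ι → α), ρ.Injective ∧ γ.Injective ∧
      (∀ i j, ρ i ≤ ρ j → γ (c i j) = ρ j - ρ i) ∧ ∀ a, γ a < Fintype.card α := by
  let e := Fintype.equivFin ι
  let e' := Fintype.equivFin α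
  refine ⟨fun i => e i, fun a => e' a, fun i j => e'.symm ⟨e j - e i, ?_⟩,
    Fin.val_injective.comp e.injective, Fin.val_injective.comp e'.injective, ?_, fun a => (e' a).2⟩
  · have := (e j).2
    omega
  · intro i j _
    simp

variable [Fintype ι] [NeZero (2 : k)]

variable (k) in
theorem exists_generators_gramIdeal (h : Fintype.card ι ≤ Fintype.card α) :
    (gramIdeal ι α k).IsRadical ∧
      ∃ (r : ℕ) (f : Fin r → MvPolynomial (ι × (α ⊕ α)) k),
        2 * r = Fintype.card ι ^ 2 + Fintype.card ι ∧ Ideal.span (Set.range f) = gramIdeal ι α k ∧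
        ringKrullDim (MvPolynomial (ι × (α ⊕ α)) k ⧸ gramIdeal ι α k) + (r : WithBot ℕ∞) =
          (Fintype.card (ι × (α ⊕ α)) : WithBot ℕ∞) := by
  classical
  obtain ⟨ρ, γ, c, hρ, hγ, hc, -⟩ := exists_row_and_column_labels h
  obtain ⟨w, hw⟩ := exists_coprimeLeadingFamily (k := k) hρ hγ hc (v := Empty.elim)
    (fun a => a.elim) (fun a => a.elim)
  have hrange : Set.range (Sum.elim (fun p : {p : ι × ι // ρ p.1 ≤ ρ p.2} =>
      halfGram (α := α) k p.1.1 p.1.2) fun e : Empty => X e.elim) =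
      Set.range fun p : {p : ι × ι // ρ p.1 ≤ ρ p.2} => halfGram (α := α) k p.1.1 p.1.2 := by
    rw [Set.Sum.elim_range, Set.range_eq_empty (fun e : Empty => X e.elim), Set.union_empty]
  refine ⟨?_, Fintype.card {p : ι × ι // ρ p.1 ≤ ρ p.2},
    fun n => (fun p : {p : ι × ι // ρ p.1 ≤ ρ p.2} => halfGram k p.1.1 p.1.2)
      ((Fintype.equivFin _).symm n), two_mul_card_ordered_pairs hρ, ?_, ?_⟩
  · have := hw.isRadical_span
    rwa [hrange, span_halfGram] at this
  · rw [← span_halfGram ρ]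
    congr 1
    exact (Fintype.equivFin _).symm.surjective.range_comp fun p : {p : ι × ι // ρ p.1 ≤ ρ p.2} =>
      halfGram (α := α) k p.1.1 p.1.2
  · have := hw.ringKrullDim_quotient_span (by
      rintro (p | e)
      · exact constantCoeff_halfGram _ _
      · exact e.elim)
    rw [hrange, span_halfGram] at this
    simpa using this

/-- If there are more column pairs than rows, the two coordinates of a row in one column pair form
a regular sequence modulo the Gram ideal. -/
theorem gramIdeal_regular_pair (h : Fintype.card ι ≤ Fintype.card α) (i : ι) :
    (∀ p, X (i, .inl none) * p ∈ gramIdeal ι (Option α) k → p ∈ gramIdeal ι (Option α) k) ∧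
    ∀ p, X (i, .inr none) * p ∈ gramIdeal ι (Option α) k ⊔ Ideal.span {X (i, .inl none)} →
      p ∈ gramIdeal ι (Option α) k ⊔ Ideal.span {X (i, .inl none)} := by
  classical
  obtain ⟨ρ, γ, c, hρ, hγ, hc, hlt⟩ := exists_row_and_column_labels h
  let γ' : Option α → ℕ := fun a => a.elim (Fintype.card α) γ
  have hγ' : γ'.Injective := by
    rintro (_ | a) (_ | b) hab
    · rfl
    · exact absurd hab (hlt b).ne'
    · exact absurd hab (hlt a).ne
    · rw [hγ hab]
  let v : Bool → ι × (Option α ⊕ Option α) := fun b => (i, bif b then .inr none else .inl none)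
  have hv : v.Injective := by
    rintro (_ | _) (_ | _) hab <;> simp_all [v]
  obtain ⟨w, hw⟩ := exists_coprimeLeadingFamily (k := k) hρ hγ' (c := fun i j => some (c i j)) hc hv
    (by rintro (_ | _) <;> simp [v])
  have hspan : Ideal.span (Sum.elim (fun p : {p : ι × ι // ρ p.1 ≤ ρ p.2} =>
      halfGram k p.1.1 p.1.2) (fun e => X (v e)) '' (Set.range Sum.inl)) =
      gramIdeal ι (Option α) k := by
    rw [← span_halfGram ρ, ← Set.range_comp, Sum.elim_comp_inl]
  have hspan' : Ideal.span (Sum.elim (fun p : {p : ι × ι // ρ p.1 ≤ ρ p.2} =>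
      halfGram k p.1.1 p.1.2) (fun e => X (v e)) '' (insert (Sum.inr false) (Set.range Sum.inl))) =
      gramIdeal ι (Option α) k ⊔ Ideal.span {X (i, .inl none)} := by
    rw [Set.image_insert_eq, Ideal.span_insert, hspan, sup_comm]
    rfl
  refine ⟨fun p hp => ?_, fun p hp => ?_⟩
  · rw [← hspan] at hp ⊢
    exact hw.mem_span_of_mul_mem (i := .inr false) (by simp) hp
  · rw [← hspan'] at hp ⊢
    exact hw.mem_span_of_mul_mem (i := .inr true) (by simp) hp

end GramIdeal

section Normality

open nonZeroDivisors

lemma dvd_of_dvd_pow_mul {B : Type*} [CommRing B] {u v : B}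
    (h : ∀ x, u ∣ v * x → u ∣ x) (m : ℕ) {x : B} (hx : u ∣ v ^ m * x) : u ∣ x := by
  induction m with
  | zero => simpa using hx
  | succ m ih => exact ih (h _ (by rwa [← mul_assoc, ← pow_succ']))

lemma pow_dvd_of_pow_dvd_pow_mul {B : Type*} [CommRing B] {u v : B} (hu : u ∈ B⁰)
    (h : ∀ x, u ∣ v * x → u ∣ x) (m n : ℕ) {x : B} (hx : u ^ n ∣ v ^ m * x) : u ^ n ∣ x := by
  induction n generalizing x with
  | zero => simp
  | succ n ih =>
    obtain ⟨y, rfl⟩ := dvd_of_dvd_pow_mul h m ((dvd_pow_self u n.succ_ne_zero).trans hx)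
    rw [pow_succ']
    refine mul_dvd_mul_left u (ih ?_)
    obtain ⟨z, hz⟩ := hx
    refine ⟨z, (mul_cancel_left_mem_nonZeroDivisors hu).1 ?_⟩
    linear_combination hz

/-- A ring is an integrally closed domain if its localizations at the two members of a regular
sequence are so. -/
theorem isIntegrallyClosed_of_regular_pair {B : Type*} [CommRing B] {u v : B} (hu : u ∈ B⁰)
    (hv0 : v ≠ 0) (huv : ∀ x, u ∣ v * x → u ∣ x) [IsDomain (Localization.Away u)]
    [IsIntegrallyClosed (Localization.Away u)] [IsIntegrallyClosed (Localization.Away v)] :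
    IsDomain B ∧ IsIntegrallyClosed B := by
  have hdom : IsDomain B := (IsLocalization.injective (Localization.Away u)
    (M := Submonoid.powers u) (Submonoid.powers_le.2 hu)).isDomain _
  refine ⟨hdom, ?_⟩
  have hpow : ∀ b : Bool, Submonoid.powers (cond b u v) ≤ B⁰ := by
    rintro (_ | _)
    · exact Submonoid.powers_le.2 (mem_nonZeroDivisors_of_ne_zero hv0)
    · exact Submonoid.powers_le.2 hu
  refine IsIntegrallyClosed.of_localization_submonoid
    (fun b : Bool => Submonoid.powers (cond b u v)) hpow (by rintro (_ | _) <;> assumption) ?_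
  rw [eq_bot_iff]
  intro x hx
  rw [Algebra.mem_iInf] at hx
  obtain ⟨a, s, ⟨n, rfl⟩, ha⟩ := hx true
  obtain ⟨b, t, ⟨m, rfl⟩, hb⟩ := hx false
  have hK : (algebraMap B (FractionRing B) (u ^ n)) ≠ 0 :=
    IsFractionRing.to_map_ne_zero_of_mem_nonZeroDivisors (hpow true ⟨n, rfl⟩)
  rw [IsLocalization.eq_mk'_iff_mul_eq] at ha hb
  simp only [cond_true, cond_false] at ha hb
  have hdvd : u ^ n ∣ v ^ m * a := by
    refine ⟨b, IsFractionRing.injective B (FractionRing B) ?_⟩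
    rw [map_mul, map_mul, ← ha, ← hb]
    ring
  obtain ⟨c, rfl⟩ := pow_dvd_of_pow_dvd_pow_mul hu huv m n hdvd
  refine Algebra.mem_bot.2 ⟨c, mul_right_cancel₀ hK ?_⟩
  rw [ha, map_mul, mul_comm]

lemma isIntegrallyClosed_mvPolynomial (σ : Type*) [Finite σ] (R : Type*) [CommRing R] [IsDomain R]
    [IsIntegrallyClosed R] : IsIntegrallyClosed (MvPolynomial σ R) := by
  induction σ using Finite.induction_empty_option with
  | of_equiv e h => exact h.of_equiv (renameEquiv R e).toRingEquiv
  | h_empty => exact ‹IsIntegrallyClosed R›.of_equiv (isEmptyRingEquiv R PEmpty).symm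
  | @h_option τ _ h =>
    exact IsIntegrallyClosed.of_equiv (R := Polynomial (MvPolynomial τ R))
      (optionEquivLeft R τ).symm.toRingEquiv

lemma isIntegrallyClosed_away_X {σ : Type*} [Finite σ] (R : Type*) [CommRing R] [IsDomain R]
    [IsIntegrallyClosed R] (s : σ) :
    IsDomain (Localization.Away (X s : MvPolynomial σ R)) ∧
      IsIntegrallyClosed (Localization.Away (X s : MvPolynomial σ R)) := by
  have := isIntegrallyClosed_mvPolynomial σ R
  have hle : Submonoid.powers (X s : MvPolynomial σ R) ≤ (MvPolynomial σ R)⁰ :=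
    Submonoid.powers_le.2 (mem_nonZeroDivisors_of_ne_zero (X_ne_zero _))
  exact ⟨IsLocalization.isDomain_localization hle, isIntegrallyClosed_of_isLocalization _ _ hle⟩

/-- A version of `isIntegrallyClosed_of_regular_pair` where an automorphism exchanges the two
charts. -/
theorem isIntegrallyClosed_of_regular_pair_of_ringEquiv {B : Type*} [CommRing B] {u v : B}
    (τ : B ≃+* B) (hτ : τ u = v) (hu : ∀ x, u * x = 0 → x = 0) (huv : ∀ x, u ∣ v * x → u ∣ x)
    (h : IsDomain (Localization.Away u)) (h' : IsIntegrallyClosed (Localization.Away u)) :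
    IsDomain B ∧ IsIntegrallyClosed B := by
  have h3 : IsIntegrallyClosed (Localization.Away v) :=
    h'.of_equiv (IsLocalization.ringEquivOfRingEquiv (M := Submonoid.powers u)
      (T := Submonoid.powers v) _ _ τ (by
        rw [Submonoid.map_powers]
        exact congrArg _ hτ))
  have hu' : u ∈ B⁰ := by
    rw [mem_nonZeroDivisors_iff_right]
    exact fun x hx => hu x (by rwa [mul_comm])
  have hnt : Nontrivial B := (algebraMap B (Localization.Away u)).domain_nontrivial
  refine isIntegrallyClosed_of_regular_pair hu' ?_ huv
  rw [← hτ]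
  exact (map_ne_zero_iff _ τ.injective).2 (nonZeroDivisors.ne_zero hu')

lemma mk_dvd_mk_iff {R : Type*} [CommRing R] {I : Ideal R} (a b : R) :
    Ideal.Quotient.mk I a ∣ Ideal.Quotient.mk I b ↔ b ∈ I ⊔ Ideal.span {a} := by
  rw [← Ideal.mem_span_singleton, sup_comm, ← Ideal.mem_quotient_iff_mem_sup, Ideal.map_span,
    Set.image_singleton]

variable {ι α : Type*} [Fintype α] {T : Type*} [CommRing T]

lemma hyperbolic_comm (x y : α ⊕ α → T) : hyperbolic x y = hyperbolic y x :=
  Finset.sum_congr rfl fun a _ => by ring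

lemma hyperbolic_add_smul_left (x y z : α ⊕ α → T) (c : T) :
    hyperbolic (x + c • y) z = hyperbolic x z + c * hyperbolic y z := by
  rw [hyperbolic, hyperbolic, hyperbolic, Finset.mul_sum, ← Finset.sum_add_distrib]
  exact Finset.sum_congr rfl fun a _ => by simp; ring

lemma hyperbolic_add_smul_right (x y z : α ⊕ α → T) (c : T) :
    hyperbolic z (x + c • y) = hyperbolic z x + c * hyperbolic z y := by
  simp only [hyperbolic_comm z, hyperbolic_add_smul_left]

/-- The quadratic form with polar form `hyperbolic`. -/
def hyperbolicQuad (x : α ⊕ α → T) : T := ∑ a, x (.inl a) * x (.inr a)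

lemma hyperbolic_self (x : α ⊕ α → T) : hyperbolic x x = 2 * hyperbolicQuad x := by
  rw [hyperbolic, hyperbolicQuad, Finset.mul_sum]
  exact Finset.sum_congr rfl fun a _ => by ring

lemma map_hyperbolic {F T' : Type*} [CommRing T'] [FunLike F T T'] [RingHomClass F T T'] (f : F)
    (x y : α ⊕ α → T) :
    f (hyperbolic x y) = hyperbolic (fun c => f (x c)) fun c => f (y c) := by
  simp [hyperbolic]

lemma map_hyperbolicQuad {F T' : Type*} [CommRing T'] [FunLike F T T'] [RingHomClass F T T'] (f : F)
    (x : α ⊕ α → T) : f (hyperbolicQuad x) = hyperbolicQuad fun c => f (x c) := by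
  simp [hyperbolicQuad]

/-- The vector of the hyperbolic space of rank one more with two new coordinates `a` and `b`. -/
def extend (a b : T) (x : α ⊕ α → T) : Option α ⊕ Option α → T
  | .inl none => a
  | .inr none => b
  | .inl (some c) => x (.inl c)
  | .inr (some c) => x (.inr c)

lemma hyperbolic_extend (a b a' b' : T) (x y : α ⊕ α → T) :
    hyperbolic (extend a b x) (extend a' b' y) = a * b' + b * a' + hyperbolic x y := by
  rw [hyperbolic, Fintype.sum_option]
  rfl

lemma hyperbolicQuad_extend (a b : T) (x : α ⊕ α → T) :
    hyperbolicQuad (extend a b x) = a * b + hyperbolicQuad x := by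
  rw [hyperbolicQuad, Fintype.sum_option]
  rfl

/-- The part of a vector in the hyperbolic subspace of rank one less. -/
def core (x : Option α ⊕ Option α → T) : α ⊕ α → T := x ∘ Sum.map some some

lemma extend_core {β S : Type*} (x : Option β ⊕ Option β → S) :
    extend (x (.inl none)) (x (.inr none)) (core x) = x := by
  funext c
  rcases c with (_ | _) | (_ | _) <;> rfl

/-- A family of isotropic, pairwise orthogonal vectors in a hyperbolic space, built from such a
family `x` in a smaller hyperbolic space, a new vector with first coordinate `U` and core `P`, and
the first coordinates `X` of the other vectors; `V` is the inverse of `U`. -/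
def extendFamily (U V : T) (X : ι → T) (P : α ⊕ α → T) (x : ι → α ⊕ α → T) :
    Option ι → Option α ⊕ Option α → T
  | none => extend U (-V * hyperbolicQuad P) P
  | some i => extend (X i) (X i * V * (-V * hyperbolicQuad P) - V * hyperbolic (x i) P)
      (x i + (X i * V) • P)

lemma hyperbolic_extendFamily {U V : T} (hUV : U * V = 1) (X : ι → T) (P : α ⊕ α → T)
    {x : ι → α ⊕ α → T} (hx : ∀ i j, hyperbolic (x i) (x j) = 0) (i j : Option ι) :
    hyperbolic (extendFamily U V X P x i) (extendFamily U V X P x j) = 0 := by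
  rcases i with _ | i <;> rcases j with _ | j
  · simp only [extendFamily, hyperbolic_extend]
    rw [hyperbolic_self]
    linear_combination (-2 * hyperbolicQuad P) * hUV
  · simp only [extendFamily, hyperbolic_extend, hyperbolic_self, hyperbolic_add_smul_right,
      hyperbolic_comm P (x j)]
    linear_combination (-hyperbolic (x j) P - X j * V * hyperbolicQuad P) * hUV
  · simp only [extendFamily, hyperbolic_extend, hyperbolic_self, hyperbolic_add_smul_left]
    linear_combination (-hyperbolic (x i) P - X i * V * hyperbolicQuad P) * hUV
  · simp only [extendFamily, hyperbolic_extend, hyperbolic_self, hyperbolic_add_smul_left,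
      hyperbolic_add_smul_right, hx, hyperbolic_comm P (x j)]
    ring

/-- The projection of a vector `y` of the hyperbolic space to `z^⊥ / z`, where `V` is the inverse of
the first coordinate of `z`. -/
def project (V : T) (z y : Option α ⊕ Option α → T) : α ⊕ α → T :=
  core y + (-(y (.inl none) * V)) • core z

lemma hyperbolic_project {V : T} {z y y' : Option α ⊕ Option α → T} (hV : z (.inl none) * V = 1)
    (hzz : hyperbolicQuad z = 0) (hz : hyperbolic z y = 0) (hz' : hyperbolic z y' = 0)
    (hy : hyperbolic y y' = 0) : hyperbolic (project V z y) (project V z y') = 0 := by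
  rw [← extend_core z, hyperbolicQuad_extend] at hzz
  rw [← extend_core z, ← extend_core y, hyperbolic_extend] at hz
  rw [← extend_core z, ← extend_core y', hyperbolic_extend] at hz'
  rw [← extend_core y, ← extend_core y', hyperbolic_extend] at hy
  simp only [project, hyperbolic_add_smul_left, hyperbolic_add_smul_right, hyperbolic_self,
    hyperbolic_comm (core y) (core z)]
  linear_combination hy - y' (.inl none) * V * hz - y (.inl none) * V * hz' +
    2 * y (.inl none) * V * y' (.inl none) * V * hzz +
    (y (.inl none) * y' (.inr none) + y' (.inl none) * y (.inr none) -
      2 * y (.inl none) * y' (.inl none) * V * z (.inr none)) * hV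

lemma extendFamily_project {V : T} {b : Option ι → Option α ⊕ Option α → T}
    (hV : b none (.inl none) * V = 1) (hquad : hyperbolicQuad (b none) = 0)
    (hb : ∀ i, hyperbolic (b none) (b (some i)) = 0) :
    extendFamily (b none (.inl none)) V (fun i => b (some i) (.inl none)) (core (b none))
      (fun i => project V (b none) (b (some i))) = b := by
  rw [← extend_core (b none), hyperbolicQuad_extend] at hquad
  have h0 : -V * hyperbolicQuad (core (b none)) = b none (.inr none) := by
    linear_combination (-V) * hquad + b none (.inr none) * hV
  funext i
  rcases i with _ | i
  · rw [extendFamily, h0, extend_core]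
  · have hi := hb i
    rw [← extend_core (b none), ← extend_core (b (some i)), hyperbolic_extend] at hi
    have h1 : b (some i) (.inl none) * V * (-V * hyperbolicQuad (core (b none))) -
        V * hyperbolic (project V (b none) (b (some i))) (core (b none)) =
        b (some i) (.inr none) := by
      rw [project, hyperbolic_add_smul_left, hyperbolic_self,
        hyperbolic_comm (core (b (some i)))]
      linear_combination (-V) * hi + (b (some i) (.inr none)) * hV +
        b (some i) (.inl none) * V ^ 2 * hquad -
        b (some i) (.inl none) * b none (.inr none) * V * hV
    have h2 : project V (b none) (b (some i)) + (b (some i) (.inl none) * V) • core (b none) =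
        core (b (some i)) := by
      rw [project, neg_smul, neg_add_cancel_right]
    rw [extendFamily, h1, h2, extend_core]

lemma project_extendFamily (U V : T) (X : ι → T) (P : α ⊕ α → T) (x : ι → α ⊕ α → T) (i : ι) :
    project V (extendFamily U V X P x none) (extendFamily U V X P x (some i)) = x i := by
  have h1 : core (extendFamily U V X P x none) = P := by
    funext c; rcases c with _ | _ <;> rfl
  have h2 : core (extendFamily U V X P x (some i)) = x i + (X i * V) • P := by
    funext c; rcases c with _ | _ <;> rfl
  rw [project, h1, h2, neg_smul, ← sub_eq_add_neg]
  exact add_sub_cancel_right _ _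

lemma core_extendFamily_none (U V : T) (X : ι → T) (P : α ⊕ α → T) (x : ι → α ⊕ α → T)
    (c : α ⊕ α) : core (extendFamily U V X P x none) c = P c := by
  rcases c with _ | _ <;> rfl

lemma map_extendFamily {T' : Type*} [CommRing T'] (f : T →+* T') (U V : T) (X : ι → T)
    (P : α ⊕ α → T) (x : ι → α ⊕ α → T) (i : Option ι) (c : Option α ⊕ Option α) :
    f (extendFamily U V X P x i c) =
      extendFamily (f U) (f V) (fun i => f (X i)) (fun c => f (P c)) (fun i c => f (x i c)) i c := by
  rcases i with _ | i <;> rcases c with (_ | c) | (_ | c) <;>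
    simp [extendFamily, extend, map_hyperbolic, map_hyperbolicQuad]

lemma map_project {β T' : Type*} [CommRing T'] (f : T →+* T') (V : T)
    (z y : Option β ⊕ Option β → T) (c : β ⊕ β) :
    f (project V z y c) = project (f V) (fun c => f (z c)) (fun c => f (y c)) c := by
  simp [project, core]

section GramRing

variable (ι α) in
/-- The coordinate ring of the scheme of families of vectors that span a totally isotropic
subspace. -/
abbrev GramRing (k : Type*) [Field k] : Type _ := MvPolynomial (ι × (α ⊕ α)) k ⧸ gramIdeal ι α k

variable {k : Type*} [Field k]

/-- The coordinates of the universal family. -/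
noncomputable def gramX (k : Type*) [Field k] (i : ι) (c : α ⊕ α) : GramRing ι α k :=
  Ideal.Quotient.mk _ (X (i, c))

lemma hyperbolic_gramX (i j : ι) : hyperbolic (gramX (α := α) k i) (gramX k j) = 0 := by
  have := Ideal.Quotient.eq_zero_iff_mem.2 (Ideal.subset_span (Set.mem_range_self
    (f := fun p : ι × ι => hyperbolic (fun c : α ⊕ α =>
      (X (p.1, c) : MvPolynomial (ι × (α ⊕ α)) k)) fun c => X (p.2, c)) (i, j)))
  rw [map_hyperbolic] at this
  exact this

/-- The universal property of the ring of totally isotropic families. -/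
noncomputable def gramLift [Algebra k T] (x : ι → α ⊕ α → T)
    (hx : ∀ i j, hyperbolic (x i) (x j) = 0) : GramRing ι α k →ₐ[k] T :=
  Ideal.Quotient.liftₐ _ (aeval fun p => x p.1 p.2) (by
    have : gramIdeal ι α k ≤ RingHom.ker (aeval fun p : ι × (α ⊕ α) => x p.1 p.2) := by
      rw [gramIdeal, Ideal.span_le]
      rintro _ ⟨⟨i, j⟩, rfl⟩
      rw [SetLike.mem_coe, RingHom.mem_ker, map_hyperbolic]
      simpa using hx i j
    exact fun a ha => RingHom.mem_ker.1 (this ha))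

@[simp]
lemma gramLift_gramX [Algebra k T] (x : ι → α ⊕ α → T)
    (hx : ∀ i j, hyperbolic (x i) (x j) = 0) (i : ι) (c : α ⊕ α) :
    gramLift (k := k) x hx (gramX k i c) = x i c := by
  change aeval (fun p : ι × (α ⊕ α) => x p.1 p.2) (X (i, c)) = x i c
  simp

lemma gramRing_algHom_ext [Algebra k T] {f g : GramRing ι α k →ₐ[k] T}
    (h : ∀ i c, f (gramX k i c) = g (gramX k i c)) : f = g :=
  Ideal.Quotient.algHom_ext _ (MvPolynomial.algHom_ext fun p => h p.1 p.2)

/-- Exchanging the two coordinates in every column pair, as a homomorphism. -/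
noncomputable def gramSwapHom (ι α : Type*) [Fintype α] (k : Type*) [Field k] :
    GramRing ι α k →ₐ[k] GramRing ι α k :=
  gramLift (fun i c => gramX k i c.swap) fun i j => by
    rw [← hyperbolic_gramX (k := k) i j, hyperbolic, hyperbolic]
    exact Finset.sum_congr rfl fun a _ => add_comm _ _

lemma gramSwapHom_gramX (i : ι) (c : α ⊕ α) :
    gramSwapHom ι α k (gramX k i c) = gramX k i c.swap := by
  rw [gramSwapHom, gramLift_gramX]

/-- Exchanging the two coordinates in every column pair. -/
noncomputable def gramSwap (ι α : Type*) [Fintype α] (k : Type*) [Field k] :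
    GramRing ι α k ≃ₐ[k] GramRing ι α k :=
  have h : (gramSwapHom ι α k).comp (gramSwapHom ι α k) = AlgHom.id k _ :=
    gramRing_algHom_ext fun i c => by simp [gramSwapHom_gramX]
  .ofAlgHom (gramSwapHom ι α k) (gramSwapHom ι α k) h h

lemma gramSwap_gramX (i : ι) (c : α ⊕ α) : gramSwap ι α k (gramX k i c) = gramX k i c.swap :=
  gramSwapHom_gramX i c

/-- Relabelling rows and columns. -/
noncomputable def gramCongr {ι' α' : Type*} [Fintype α'] (e : ι ≃ ι') (e' : α ≃ α') (k : Type*)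
    [Field k] : GramRing ι α k ≃ₐ[k] GramRing ι' α' k :=
  .ofAlgHom
    (gramLift (fun i c => gramX k (e i) (c.map e' e')) fun i j => by
      rw [← hyperbolic_gramX (k := k) (e i) (e j), hyperbolic, hyperbolic, ← e'.sum_comp]
      rfl)
    (gramLift (fun i c => gramX k (e.symm i) (c.map e'.symm e'.symm)) fun i j => by
      rw [← hyperbolic_gramX (k := k) (e.symm i) (e.symm j), hyperbolic, hyperbolic,
        ← e'.symm.sum_comp]
      rfl)
    (gramRing_algHom_ext fun i c => by simp) (gramRing_algHom_ext fun i c => by simp)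

lemma hyperbolicQuad_eq_zero [Algebra k T] [NeZero (2 : k)] {x : α ⊕ α → T}
    (hx : hyperbolic x x = 0) : hyperbolicQuad x = 0 := by
  rw [hyperbolic_self] at hx
  have h2 : algebraMap k T 2⁻¹ * 2 = 1 := by
    rw [← map_ofNat (algebraMap k T) 2, ← map_mul, inv_mul_cancel₀ (NeZero.ne (2 : k)), map_one]
  linear_combination algebraMap k T 2⁻¹ * hx - hyperbolicQuad x * h2

end GramRing

end Normality

section Localization

open nonZeroDivisors

variable (ι α : Type*) [Fintype α] (k : Type*) [Field k]

/-- The polynomial ring over the ring of totally isotropic families whose localization describes the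
larger families in which one coordinate is invertible. -/
abbrev ModelPoly : Type _ := MvPolynomial (Option ι ⊕ (α ⊕ α)) (GramRing ι α k)

/-- The localization of `ModelPoly` at one variable. -/
abbrev Model : Type _ := Localization.Away (X (.inl none) : ModelPoly ι α k)

/-- The chart of the scheme of totally isotropic families where one coordinate is invertible. -/
abbrev Chart : Type _ :=
  Localization.Away (gramX k none (.inl none) : GramRing (Option ι) (Option α) k)

variable {ι α k}

/-- The coordinates of the universal family on the chart. -/
noncomputable def chartX (i : Option ι) (c : Option α ⊕ Option α) : Chart ι α k :=
  algebraMap (GramRing (Option ι) (Option α) k) _ (gramX k i c)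

variable (ι α k) in
/-- The inverse of the invertible coordinate on the chart. -/
noncomputable def chartInv : Chart ι α k :=
  IsLocalization.Away.invSelf (gramX k none (.inl none) : GramRing (Option ι) (Option α) k)

lemma chartX_mul_chartInv : chartX none (.inl none) * chartInv ι α k = 1 :=
  IsLocalization.Away.mul_invSelf _

lemma hyperbolic_chartX (i j : Option ι) :
    hyperbolic (chartX (α := α) (k := k) i) (chartX j) = 0 := by
  have := congrArg (algebraMap _ (Chart ι α k)) (hyperbolic_gramX (α := Option α) (k := k) i j)
  rw [map_zero, map_hyperbolic] at this
  exact this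

/-- The variables of the model. -/
noncomputable def modelX (s : Option ι ⊕ (α ⊕ α)) : Model ι α k :=
  algebraMap (ModelPoly ι α k) _ (X s)

variable (ι α k) in
/-- The inverse of the invertible variable of the model. -/
noncomputable def modelInv : Model ι α k :=
  IsLocalization.Away.invSelf (X (.inl none) : ModelPoly ι α k)

lemma modelX_mul_modelInv : modelX (.inl none) * modelInv ι α k = 1 :=
  IsLocalization.Away.mul_invSelf _

/-- The coordinates of the smaller universal family in the model. -/
noncomputable def modelBase (i : ι) (c : α ⊕ α) : Model ι α k :=
  algebraMap (ModelPoly ι α k) _ (C (gramX k i c))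

lemma hyperbolic_modelBase (i j : ι) :
    hyperbolic (modelBase (α := α) (k := k) i) (modelBase j) = 0 := by
  have := congrArg (algebraMap (ModelPoly ι α k) (Model ι α k))
    (congrArg C (hyperbolic_gramX (α := α) (k := k) i j))
  rw [map_zero, map_zero, map_hyperbolic, map_hyperbolic] at this
  exact this

variable (ι α k) in
/-- The family of vectors over the model. -/
noncomputable def modelFamily : Option ι → Option α ⊕ Option α → Model ι α k :=
  extendFamily (modelX (.inl none)) (modelInv ι α k) (fun i => modelX (.inl (some i)))
    (fun c => modelX (.inr c)) modelBase

lemma hyperbolic_modelFamily (i j : Option ι) :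
    hyperbolic (modelFamily ι α k i) (modelFamily ι α k j) = 0 :=
  hyperbolic_extendFamily modelX_mul_modelInv _ _ hyperbolic_modelBase i j

lemma modelFamily_none_inl_none : modelFamily ι α k none (.inl none) = modelX (.inl none) := rfl

/-- The comparison map from the chart to the model. -/
noncomputable def chartToModel : Chart ι α k →ₐ[k] Model ι α k :=
  IsLocalization.Away.liftAlgHom (gramX k none (.inl none) : GramRing (Option ι) (Option α) k)
    (f := gramLift (modelFamily ι α k) hyperbolic_modelFamily) (by
    rw [gramLift_gramX, modelFamily_none_inl_none]
    exact IsUnit.of_mul_eq_one _ modelX_mul_modelInv)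

lemma chartToModel_chartX (i : Option ι) (c : Option α ⊕ Option α) :
    chartToModel (chartX i c) = modelFamily ι α k i c := by
  rw [chartToModel, IsLocalization.Away.liftAlgHom_apply, chartX, IsLocalization.Away.lift_eq]
  exact gramLift_gramX _ _ i c

lemma chartToModel_chartInv : chartToModel (chartInv ι α k) = modelInv ι α k := by
  have h1 := congrArg chartToModel (chartX_mul_chartInv (ι := ι) (α := α) (k := k))
  rw [map_mul, map_one, chartToModel_chartX] at h1
  have h2 := modelX_mul_modelInv (ι := ι) (α := α) (k := k)
  rw [modelFamily_none_inl_none] at h1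
  linear_combination modelInv ι α k * h1 - chartToModel (chartInv ι α k) * h2

lemma model_algHom_ext {T : Type*} [CommRing T] [Algebra k T] {f g : Model ι α k →ₐ[k] T}
    (hX : ∀ s, f (modelX s) = g (modelX s)) (hb : ∀ i c, f (modelBase i c) = g (modelBase i c)) :
    f = g := by
  refine AlgHom.coe_ringHom_injective (IsLocalization.ringHom_ext
    (Submonoid.powers (X (.inl none) : ModelPoly ι α k)) ?_)
  have : f.comp (IsScalarTower.toAlgHom k (ModelPoly ι α k) (Model ι α k)) =
      g.comp (IsScalarTower.toAlgHom k (ModelPoly ι α k) (Model ι α k)) :=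
    MvPolynomial.algHom_ext' (gramRing_algHom_ext hb) hX
  exact congrArg (fun f : ModelPoly ι α k →ₐ[k] T => (f : ModelPoly ι α k →+* T)) this

lemma chart_algHom_ext {T : Type*} [CommRing T] [Algebra k T] {f g : Chart ι α k →ₐ[k] T}
    (h : ∀ i c, f (chartX i c) = g (chartX i c)) : f = g := by
  refine AlgHom.coe_ringHom_injective (IsLocalization.ringHom_ext
    (Submonoid.powers (gramX k none (.inl none) : GramRing (Option ι) (Option α) k)) ?_)
  have : f.comp (IsScalarTower.toAlgHom k (GramRing (Option ι) (Option α) k) (Chart ι α k)) =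
      g.comp (IsScalarTower.toAlgHom k (GramRing (Option ι) (Option α) k) (Chart ι α k)) :=
    gramRing_algHom_ext h
  exact congrArg (fun f : GramRing (Option ι) (Option α) k →ₐ[k] T =>
    (f : GramRing (Option ι) (Option α) k →+* T)) this

variable [NeZero (2 : k)]

/-- The comparison map from the model to the chart. -/
noncomputable def modelToChart : Model ι α k →ₐ[k] Chart ι α k :=
  IsLocalization.Away.liftAlgHom (X (.inl none) : ModelPoly ι α k)
    (f := aevalTower
      (gramLift (fun i => project (chartInv ι α k) (chartX none) (chartX (some i))) fun i j =>
        hyperbolic_project chartX_mul_chartInv (hyperbolicQuad_eq_zero (k := k)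
          (hyperbolic_chartX none none)) (hyperbolic_chartX _ _) (hyperbolic_chartX _ _)
          (hyperbolic_chartX _ _))
      (Sum.elim (fun i => chartX i (.inl none)) (core (chartX none)))) (by
    rw [aevalTower_X]
    exact IsUnit.of_mul_eq_one _ chartX_mul_chartInv)

lemma modelToChart_modelX (s : Option ι ⊕ (α ⊕ α)) :
    modelToChart (modelX s : Model ι α k) =
      Sum.elim (fun i => chartX i (.inl none)) (core (chartX none)) s := by
  rw [modelToChart, IsLocalization.Away.liftAlgHom_apply, modelX, IsLocalization.Away.lift_eq]
  exact aevalTower_X _ _ s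

lemma modelToChart_modelBase (i : ι) (c : α ⊕ α) :
    modelToChart (modelBase i c : Model ι α k) =
      project (chartInv ι α k) (chartX none) (chartX (some i)) c := by
  rw [modelToChart, IsLocalization.Away.liftAlgHom_apply, modelBase, IsLocalization.Away.lift_eq]
  exact (aevalTower_C _ _ _).trans (gramLift_gramX _ _ i c)

lemma modelToChart_modelInv : modelToChart (modelInv ι α k) = chartInv ι α k := by
  have h1 := congrArg modelToChart (modelX_mul_modelInv (ι := ι) (α := α) (k := k))
  rw [map_mul, map_one, modelToChart_modelX] at h1
  have h2 := chartX_mul_chartInv (ι := ι) (α := α) (k := k)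
  simp only [Sum.elim_inl] at h1
  linear_combination chartInv ι α k * h1 - modelToChart (modelInv ι α k) * h2

lemma chartToModel_comp_modelToChart :
    chartToModel.comp modelToChart = AlgHom.id k (Model ι α k) := by
  refine model_algHom_ext (fun s => ?_) fun i c => ?_
  · rw [AlgHom.comp_apply, modelToChart_modelX, AlgHom.id_apply]
    rcases s with (_ | i) | c
    · exact chartToModel_chartX _ _
    · exact chartToModel_chartX _ _
    · exact (chartToModel_chartX _ _).trans (core_extendFamily_none _ _ _ _ _ c)
  · rw [AlgHom.comp_apply, modelToChart_modelBase, AlgHom.id_apply]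
    refine (map_project (chartToModel : Chart ι α k →ₐ[k] Model ι α k).toRingHom
      (chartInv ι α k) (chartX none) (chartX (some i)) c).trans ?_
    simp only [AlgHom.toRingHom_eq_coe, RingHom.coe_coe, chartToModel_chartInv,
      chartToModel_chartX]
    exact congrFun (project_extendFamily _ _ _ _ _ i) c

lemma modelToChart_comp_chartToModel :
    modelToChart.comp chartToModel = AlgHom.id k (Chart ι α k) := by
  refine chart_algHom_ext fun i c => ?_
  rw [AlgHom.comp_apply, chartToModel_chartX, AlgHom.id_apply]
  refine (map_extendFamily (modelToChart : Model ι α k →ₐ[k] Chart ι α k).toRingHom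
    (modelX (.inl none)) (modelInv ι α k) (fun i => modelX (.inl (some i)))
    (fun c => modelX (.inr c)) modelBase i c).trans ?_
  simp only [AlgHom.toRingHom_eq_coe, RingHom.coe_coe, modelToChart_modelInv,
    modelToChart_modelBase, modelToChart_modelX, Sum.elim_inl, Sum.elim_inr]
  have h := extendFamily_project (chartX_mul_chartInv (ι := ι) (α := α) (k := k))
    (hyperbolicQuad_eq_zero (k := k) (hyperbolic_chartX none none))
    fun i => hyperbolic_chartX none (some i)
  exact congrFun (congrFun h i) c

/-- The chart is a localization of a polynomial ring over the ring of smaller families. -/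
noncomputable def chartEquiv : Chart ι α k ≃ₐ[k] Model ι α k :=
  .ofAlgHom chartToModel modelToChart chartToModel_comp_modelToChart modelToChart_comp_chartToModel

lemma isIntegrallyClosed_chart [Finite ι] (h : IsDomain (GramRing ι α k))
    (h' : IsIntegrallyClosed (GramRing ι α k)) :
    IsDomain (Chart ι α k) ∧ IsIntegrallyClosed (Chart ι α k) := by
  obtain ⟨h1, h2⟩ := isIntegrallyClosed_away_X (σ := Option ι ⊕ (α ⊕ α)) (GramRing ι α k)
    (.inl none)
  exact ⟨(chartEquiv (ι := ι) (α := α) (k := k)).toMulEquiv.isDomain,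
    h2.of_equiv (chartEquiv (ι := ι) (α := α) (k := k)).symm.toRingEquiv⟩

lemma gramX_regular [Fintype ι] (h : Fintype.card ι ≤ Fintype.card α) (i : ι) :
    (∀ x : GramRing ι (Option α) k, gramX k i (.inl none) * x = 0 → x = 0) ∧
    ∀ x : GramRing ι (Option α) k, gramX k i (.inl none) ∣ gramX k i (.inr none) * x →
      gramX k i (.inl none) ∣ x := by
  obtain ⟨hreg, hreg'⟩ := gramIdeal_regular_pair (k := k) h i
  refine ⟨fun x hx => ?_, fun x hx => ?_⟩
  · obtain ⟨p, rfl⟩ := Ideal.Quotient.mk_surjective x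
    rw [gramX, ← map_mul, Ideal.Quotient.eq_zero_iff_mem] at hx
    exact Ideal.Quotient.eq_zero_iff_mem.2 (hreg p hx)
  · obtain ⟨p, rfl⟩ := Ideal.Quotient.mk_surjective x
    rw [gramX, gramX, ← map_mul, mk_dvd_mk_iff] at hx
    rw [gramX, mk_dvd_mk_iff]
    exact hreg' p hx

lemma isIntegrallyClosed_gramRing_option [Fintype ι] (hA : IsDomain (GramRing ι α k))
    (hA' : IsIntegrallyClosed (GramRing ι α k)) (h : Fintype.card ι < Fintype.card α) :
    IsDomain (GramRing (Option ι) (Option α) k) ∧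
      IsIntegrallyClosed (GramRing (Option ι) (Option α) k) := by
  obtain ⟨hreg, hreg'⟩ := gramX_regular (k := k) (ι := Option ι) (α := α)
    (by rw [Fintype.card_option]; exact h) none
  obtain ⟨h1, h2⟩ := isIntegrallyClosed_chart hA hA'
  exact isIntegrallyClosed_of_regular_pair_of_ringEquiv
    (gramSwap (Option ι) (Option α) k).toRingEquiv (gramSwap_gramX none (.inl none))
    hreg hreg' h1 h2

variable (k) in
/-- If there are more column pairs than rows, the scheme of totally isotropic families is integral
and normal. -/
theorem isIntegrallyClosed_gramRing (ι α : Type) [Fintype ι] [Fintype α]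
    (h : Fintype.card ι < Fintype.card α) :
    IsDomain (GramRing ι α k) ∧ IsIntegrallyClosed (GramRing ι α k) := by
  induction hn : Fintype.card ι generalizing ι α with
  | zero =>
    have : IsEmpty ι := Fintype.card_eq_zero_iff.1 hn
    have hbot : gramIdeal ι α k = ⊥ := by
      rw [gramIdeal, Set.range_eq_empty, Ideal.span_empty]
    let e : GramRing ι α k ≃+* MvPolynomial (ι × (α ⊕ α)) k :=
      (Ideal.quotEquivOfEq hbot).trans (RingEquiv.quotientBot _)
    have := isIntegrallyClosed_mvPolynomial (ι × (α ⊕ α)) k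
    exact ⟨e.toMulEquiv.isDomain, .of_equiv e.symm⟩
  | succ n ih =>
    obtain ⟨m, hm⟩ : ∃ m, Fintype.card α = m + 1 := ⟨Fintype.card α - 1, by omega⟩
    let e : Option (Fin n) ≃ ι := Fintype.equivOfCardEq (by simp [hn])
    let e' : Option (Fin m) ≃ α := Fintype.equivOfCardEq (by simp [hm])
    have hlt : Fintype.card (Fin n) < Fintype.card (Fin m) := by simp; omega
    obtain ⟨h1, h2⟩ := ih (Fin n) (Fin m) hlt (by simp)
    obtain ⟨h3, h4⟩ := isIntegrallyClosed_gramRing_option (k := k) h1 h2 hlt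
    exact ⟨(gramCongr e e' k).symm.toRingEquiv.toMulEquiv.isDomain,
      .of_equiv (gramCongr e e' k).toRingEquiv⟩

end Localization

section MomentMap

open Matrix

variable {n m : ℕ}

lemma J_mul_J (n : ℕ) (R : Type*) [CommRing R] : J n R * J n R = -1 := by
  simp [J, fromBlocks_multiply, ← fromBlocks_one, fromBlocks_neg]

lemma transpose_J (n : ℕ) (R : Type*) [CommRing R] : (J n R)ᵀ = -J n R := by
  simp [J, fromBlocks_transpose, fromBlocks_neg]

lemma transpose_Q (m : ℕ) (R : Type*) [CommRing R] : (Q m R)ᵀ = Q m R := by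
  simp [Q, fromBlocks_transpose]

lemma J_eq_neg (n : ℕ) (R : Type*) [CommRing R] : J n R = -Matrix.J (Fin n) R := by
  simp [J, Matrix.J, fromBlocks_neg]

lemma mem_sp_iff {A : Matrix (Fin n ⊕ Fin n) (Fin n ⊕ Fin n) ℂ} :
    A ∈ sp n ↔ Aᵀ * J n ℂ = -(J n ℂ * A) := by
  rw [mem_skewAdjointMatricesSubmodule, Matrix.IsSkewAdjoint, Matrix.IsAdjointPair, mul_neg]

lemma mem_symplecticGroup_iff {g : Matrix (Fin n ⊕ Fin n) (Fin n ⊕ Fin n) ℂ} :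
    g ∈ symplecticGroup (Fin n) ℂ ↔ gᵀ * J n ℂ * g = J n ℂ := by
  rw [SymplecticGroup.mem_iff', J_eq_neg]
  simp

lemma inv_of_mem_symplecticGroup {g : Matrix (Fin n ⊕ Fin n) (Fin n ⊕ Fin n) ℂ}
    (hg : g ∈ symplecticGroup (Fin n) ℂ) :
    g⁻¹ * g = 1 ∧ g * g⁻¹ = 1 ∧ gᵀ * J n ℂ = J n ℂ * g⁻¹ ∧ g⁻¹ᵀ * J n ℂ = J n ℂ * g := by
  rw [mem_symplecticGroup_iff] at hg
  have h1 : -(J n ℂ * gᵀ * J n ℂ) * g = 1 := by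
    rw [neg_mul, mul_assoc, mul_assoc, ← mul_assoc gᵀ, hg, J_mul_J, neg_neg]
  have h2 : g⁻¹ = -(J n ℂ * gᵀ * J n ℂ) := inv_eq_left_inv h1
  have h3 : g⁻¹ * g = 1 := by rw [h2, h1]
  have h4 : g * g⁻¹ = 1 := mul_eq_one_comm.1 h3
  have h5 : gᵀ * J n ℂ = J n ℂ * g⁻¹ := by
    rw [← hg, mul_assoc _ g, h4, mul_one, hg]
  refine ⟨h3, h4, h5, ?_⟩
  calc g⁻¹ᵀ * J n ℂ = g⁻¹ᵀ * (gᵀ * J n ℂ * g) := by rw [hg]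
    _ = (g * g⁻¹)ᵀ * (J n ℂ * g) := by rw [transpose_mul]; simp only [mul_assoc]
    _ = J n ℂ * g := by rw [h4, transpose_one, one_mul]

lemma conj_mem_sp {g A : Matrix (Fin n ⊕ Fin n) (Fin n ⊕ Fin n) ℂ}
    (hg : g ∈ symplecticGroup (Fin n) ℂ) (hA : A ∈ sp n) : g⁻¹ * A * g ∈ sp n := by
  obtain ⟨-, -, h1, h2⟩ := inv_of_mem_symplecticGroup hg
  rw [mem_sp_iff] at hA ⊢
  calc (g⁻¹ * A * g)ᵀ * J n ℂ = gᵀ * Aᵀ * (g⁻¹ᵀ * J n ℂ) := by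
        simp only [transpose_mul, mul_assoc]
    _ = gᵀ * (Aᵀ * J n ℂ) * g := by rw [h2]; simp only [mul_assoc]
    _ = -(gᵀ * J n ℂ * A * g) := by rw [hA]; simp only [mul_neg, neg_mul, mul_assoc]
    _ = -(J n ℂ * (g⁻¹ * A * g)) := by rw [h1]; simp only [mul_assoc]

/-- The rank one element `v vᵗ J` of the symplectic Lie algebra. -/
noncomputable def rankOne (v : Fin n ⊕ Fin n → ℂ) : Matrix (Fin n ⊕ Fin n) (Fin n ⊕ Fin n) ℂ :=
  vecMulVec v v * J n ℂ

lemma dotProduct_J_swap (v w : Fin n ⊕ Fin n → ℂ) :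
    (v ᵥ* J n ℂ) ⬝ᵥ w = -((w ᵥ* J n ℂ) ⬝ᵥ v) := by
  rw [← dotProduct_mulVec, ← mulVec_transpose, transpose_J, neg_mulVec, neg_dotProduct, neg_neg,
    dotProduct_comm]

lemma rankOne_eq_vecMulVec (v : Fin n ⊕ Fin n → ℂ) : rankOne v = vecMulVec v (v ᵥ* J n ℂ) := by
  rw [rankOne, vecMulVec_mul]

lemma rankOne_mul_mul (v w : Fin n ⊕ Fin n → ℂ) :
    rankOne v * rankOne w * rankOne v = (-((v ᵥ* J n ℂ) ⬝ᵥ w) ^ 2) • rankOne v := by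
  rw [rankOne_eq_vecMulVec, rankOne_eq_vecMulVec, vecMulVec_mul_vecMulVec, vecMulVec_smul,
    Matrix.smul_mul, vecMulVec_mul_vecMulVec, vecMulVec_smul, smul_smul, dotProduct_J_swap w v]
  congr 1
  ring

lemma rankOne_mul_self (v : Fin n ⊕ Fin n → ℂ) : rankOne v * rankOne v = 0 := by
  have h := dotProduct_J_swap v v
  have h0 : (v ᵥ* J n ℂ) ⬝ᵥ v = 0 := by linear_combination h / 2
  rw [rankOne_eq_vecMulVec, vecMulVec_mul_vecMulVec, h0, zero_smul, vecMulVec_zero]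

lemma rankOne_mem_sp (v : Fin n ⊕ Fin n → ℂ) : rankOne v ∈ sp n := by
  rw [mem_sp_iff, rankOne, transpose_mul, transpose_vecMulVec, transpose_J]
  simp only [neg_mul, mul_assoc]

lemma one_add_rankOne_mem (v : Fin n ⊕ Fin n → ℂ) (c : ℂ) :
    1 + c • rankOne v ∈ symplecticGroup (Fin n) ℂ ∧
      (1 + c • rankOne v)⁻¹ = 1 - c • rankOne v := by
  have h0 := rankOne_mul_self v
  have h1 := mem_sp_iff.1 (rankOne_mem_sp v)
  constructor
  · rw [mem_symplecticGroup_iff, transpose_add, transpose_one, transpose_smul, add_mul, one_mul,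
      smul_mul_assoc, h1]
    have : (J n ℂ * rankOne v) * rankOne v = 0 := by rw [mul_assoc, h0, mul_zero]
    simp only [add_mul, mul_add, mul_one, smul_neg, neg_mul, smul_mul_assoc, mul_smul_comm, this]
    simp
  · refine inv_eq_left_inv ?_
    simp only [sub_mul, mul_add, one_mul, mul_one, smul_mul_assoc, mul_smul_comm, h0]
    simp

/-- A linear functional on `𝔰𝔭` that is invariant under the adjoint action vanishes. -/
lemma eq_zero_of_adjoint_invariant (c : Module.Dual ℂ (sp n))
    (hc : ∀ g ∈ symplecticGroup (Fin n) ℂ, ∀ A B : sp n,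
      (B : Matrix (Fin n ⊕ Fin n) (Fin n ⊕ Fin n) ℂ) = g⁻¹ * A * g → c A = c B) : c = 0 := by
  obtain ⟨d, hd⟩ := LinearMap.exists_extend c
  have hd' : ∀ A : sp n, d A = c A := fun A => LinearMap.congr_fun hd A
  have hinv : ∀ g ∈ symplecticGroup (Fin n) ℂ, ∀ A ∈ sp n, d (g⁻¹ * A * g) = d A := by
    intro g hg A hA
    rw [hd' ⟨A, hA⟩, hc g hg ⟨A, hA⟩ ⟨_, conj_mem_sp hg hA⟩ rfl, ← hd']
  have hquad : ∀ v, ∀ A ∈ sp n, d (rankOne v * A * rankOne v) = 0 := by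
    intro v A hA
    have key : ∀ s : ℂ, d ((1 - s • rankOne v) * A * (1 + s • rankOne v)) = d A := by
      intro s
      rw [← (one_add_rankOne_mem v s).2]
      exact hinv _ (one_add_rankOne_mem v s).1 A hA
    have h1 := key 1
    have h2 := key (-1)
    have hsum : (1 - (1 : ℂ) • rankOne v) * A * (1 + (1 : ℂ) • rankOne v) +
        (1 - (-1 : ℂ) • rankOne v) * A * (1 + (-1 : ℂ) • rankOne v) =
        (2 : ℂ) • A - (2 : ℂ) • (rankOne v * A * rankOne v) := by
      simp only [one_smul, neg_smul, two_smul]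
      noncomm_ring
    have h3 := congrArg d hsum
    rw [map_add, h1, h2, map_sub, map_smul, map_smul, smul_eq_mul, smul_eq_mul] at h3
    linear_combination h3 / 2
  have hrank : ∀ v, d (rankOne v) = 0 := by
    intro v
    by_cases hv : v = 0
    · simp [hv, rankOne]
    have hvJ : v ᵥ* J n ℂ ≠ 0 := by
      intro h
      apply hv
      have := congrArg (fun x => x ᵥ* J n ℂ) h
      simpa [vecMul_vecMul, J_mul_J, vecMul_neg] using this
    obtain ⟨i, hi⟩ := Function.ne_iff.1 hvJ
    have h1 := hquad v (rankOne (Pi.single i 1)) (rankOne_mem_sp _)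
    rw [rankOne_mul_mul, map_smul, smul_eq_mul, dotProduct_single, mul_one] at h1
    exact (mul_eq_zero.1 h1).resolve_left (neg_ne_zero.2 (pow_ne_zero 2 hi))
  have hpol : ∀ v w, d (vecMulVec v w * J n ℂ) + d (vecMulVec w v * J n ℂ) = 0 := by
    intro v w
    have h := hrank (v + w)
    have hv := hrank v
    have hw := hrank w
    simp only [rankOne] at h hv hw
    simp only [vecMulVec_add, add_vecMulVec, add_mul, map_add, hv, hw] at h
    linear_combination h
  ext A
  rw [← hd', LinearMap.zero_apply]
  set B := -((A : Matrix (Fin n ⊕ Fin n) (Fin n ⊕ Fin n) ℂ) * J n ℂ) with hB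
  have hBJ : (A : Matrix (Fin n ⊕ Fin n) (Fin n ⊕ Fin n) ℂ) = B * J n ℂ := by
    rw [hB, neg_mul, mul_assoc, J_mul_J, mul_neg, mul_one, neg_neg]
  have hBt : Bᵀ = B := by
    have h1 := mem_sp_iff.1 A.2
    have h2 : (A : Matrix (Fin n ⊕ Fin n) (Fin n ⊕ Fin n) ℂ)ᵀ = J n ℂ * A * J n ℂ := by
      have := congrArg (fun x => -(x * J n ℂ)) h1
      simpa [mul_assoc, J_mul_J] using this
    rw [hB, transpose_neg, transpose_mul, h2, transpose_J]
    simp [← mul_assoc, J_mul_J]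
  have hsum : ∀ M : Matrix (Fin n ⊕ Fin n) (Fin n ⊕ Fin n) ℂ, d (M * J n ℂ) =
      ∑ i, ∑ j, M i j * d (vecMulVec (Pi.single i 1) (Pi.single j 1) * J n ℂ) := by
    intro M
    conv_lhs => rw [matrix_eq_sum_single M]
    simp only [Finset.sum_mul, map_sum]
    refine Finset.sum_congr rfl fun i _ => Finset.sum_congr rfl fun j _ => ?_
    rw [← smul_eq_mul (M i j), ← map_smul, ← smul_mul_assoc]
    congr 2
    rw [← vecMulVec_smul]
    ext a b
    simp only [single_apply, vecMulVec_apply, Pi.single_apply, Pi.smul_apply, smul_eq_mul]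
    grind
  have h1 := hsum B
  have h2 := hsum B
  rw [Finset.sum_comm] at h2
  have h3 : d (B * J n ℂ) + d (B * J n ℂ) = 0 := by
    nth_rewrite 1 [h1]
    rw [h2, ← Finset.sum_add_distrib]
    refine Finset.sum_eq_zero fun i _ => ?_
    rw [← Finset.sum_add_distrib]
    refine Finset.sum_eq_zero fun j _ => ?_
    rw [show B j i = B i j by rw [← transpose_apply B, hBt], ← mul_add, hpol, mul_zero]
  rw [hBJ]
  linear_combination h3 / 2

/-- The bilinear version of `momentMatrix`. -/
def momentBilin (X Y : V n m) : Matrix (Fin n ⊕ Fin n) (Fin n ⊕ Fin n) ℂ :=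
  X * Q m ℂ * Yᵀ * J n ℂ

lemma momentMatrix_add_smul (X Y : V n m) (t : ℂ) :
    momentMatrix (X + t • Y) =
      momentMatrix X + t • (momentBilin X Y + momentBilin Y X) + t ^ 2 • momentMatrix Y := by
  simp only [momentMatrix, momentBilin, transpose_add, transpose_smul, Matrix.add_mul,
    Matrix.mul_add, Matrix.smul_mul, Matrix.mul_smul, smul_add, smul_smul, sq]
  abel

lemma trace_momentBilin_comm {A : Matrix (Fin n ⊕ Fin n) (Fin n ⊕ Fin n) ℂ} (hA : A ∈ sp n)
    (X Y : V n m) : (A * momentBilin Y X).trace = (A * momentBilin X Y).trace := by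
  rw [mem_sp_iff] at hA
  rw [← trace_transpose, momentBilin, momentBilin]
  have : (A * (Y * Q m ℂ * Xᵀ * J n ℂ))ᵀ = -(J n ℂ * (X * Q m ℂ * Yᵀ) * Aᵀ) := by
    simp only [transpose_mul, transpose_transpose, transpose_Q, transpose_J, Matrix.mul_assoc,
      Matrix.neg_mul]
  rw [this, trace_neg, trace_mul_comm, ← Matrix.mul_assoc, hA, Matrix.neg_mul, trace_neg, neg_neg,
    Matrix.mul_assoc, trace_mul_comm, Matrix.mul_assoc]

lemma mul_Q_mul_transpose (X Y : V n m) :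
    X * Q m ℂ * Yᵀ = X.toCols₂ * Y.toCols₁ᵀ + X.toCols₁ * Y.toCols₂ᵀ := by
  ext i j
  simp [Q, Matrix.mul_apply, fromBlocks, Fintype.sum_sum_type, toCols₁, toCols₂, one_apply]

lemma symplecticForm_eq_trace (A : Matrix (Fin n ⊕ Fin n) (Fin n ⊕ Fin n) ℂ) (X Y : V n m) :
    symplecticForm n m Y (A * X) = (A * momentBilin X Y).trace := by
  have h1 : (A * X).toCols₁ = A * X.toCols₁ := rfl
  have h2 : (A * X).toCols₂ = A * X.toCols₂ := rfl
  rw [symplecticForm, h1, h2, momentBilin, mul_Q_mul_transpose, Matrix.add_mul, Matrix.mul_add,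
    trace_add, sub_eq_add_neg, add_comm]
  congr 1
  · rw [← trace_transpose (A * _), ← trace_neg]
    simp only [transpose_mul, transpose_transpose, transpose_J, Matrix.neg_mul, trace_neg]
    rw [trace_mul_comm, Matrix.mul_assoc (J n ℂ), trace_mul_comm (J n ℂ)]
    simp only [Matrix.mul_assoc]
  · rw [Matrix.mul_assoc X.toCols₁, ← Matrix.mul_assoc A, trace_mul_comm (A * _)]

/-- The component of the moment map at `A`. -/
noncomputable def momentFunction (A : Matrix (Fin n ⊕ Fin n) (Fin n ⊕ Fin n) ℂ) (X : V n m) : ℂ :=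
  (A * ((1 / 2 : ℂ) • momentMatrix X)).trace

lemma momentFunction_add_smul {A : Matrix (Fin n ⊕ Fin n) (Fin n ⊕ Fin n) ℂ} (hA : A ∈ sp n)
    (X Y : V n m) (t : ℂ) : momentFunction A (X + t • Y) =
      momentFunction A X + t * symplecticForm n m Y (A * X) + t ^ 2 * momentFunction A Y := by
  rw [symplecticForm_eq_trace]
  simp only [momentFunction, momentMatrix_add_smul, smul_add, Matrix.mul_add, Matrix.mul_smul,
    trace_add, trace_smul, trace_momentBilin_comm hA X Y, smul_eq_mul]
  ring

lemma hasLineDerivAt_momentFunction {A : Matrix (Fin n ⊕ Fin n) (Fin n ⊕ Fin n) ℂ} (hA : A ∈ sp n)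
    (X Y : V n m) :
    HasLineDerivAt ℂ (momentFunction A) (symplecticForm n m Y (A * X)) X Y := by
  rw [HasLineDerivAt]
  simp only [momentFunction_add_smul hA]
  have h1 := ((hasDerivAt_id (0 : ℂ)).mul_const (symplecticForm n m Y (A * X))).const_add
    (momentFunction A X)
  have h2 := h1.add (((hasDerivAt_id (0 : ℂ)).pow 2).mul_const (momentFunction A Y))
  refine (h2.congr_deriv ?_).congr_of_eventuallyEq ?_
  · simp
  · exact Filter.Eventually.of_forall fun t => by simp

lemma momentFunction_smul_equivariant {g : Matrix (Fin n ⊕ Fin n) (Fin n ⊕ Fin n) ℂ}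
    (hg : g ∈ symplecticGroup (Fin n) ℂ) (X : V n m)
    (A : Matrix (Fin n ⊕ Fin n) (Fin n ⊕ Fin n) ℂ) :
    momentFunction A (g * X) = momentFunction (g⁻¹ * A * g) X := by
  have h : momentMatrix (g * X) = g * momentMatrix X * g⁻¹ := by
    simp only [momentMatrix, transpose_mul, Matrix.mul_assoc]
    rw [(inv_of_mem_symplecticGroup hg).2.2.1]
  simp only [momentFunction, h, Matrix.mul_smul, trace_smul]
  rw [← Matrix.mul_assoc, trace_mul_comm]
  simp only [Matrix.mul_assoc]

/-- A function with vanishing line derivatives is constant. -/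
lemma eq_of_hasLineDerivAt_zero {E : Type*} [AddCommGroup E] [Module ℂ E] {f : E → ℂ}
    (h : ∀ x v, HasLineDerivAt ℂ f 0 x v) (x : E) : f x = f 0 := by
  have hd : ∀ t : ℂ, HasDerivAt (fun s : ℂ => f (s • x)) 0 t := by
    intro t
    have h1 : HasDerivAt (fun s : ℂ => f (t • x + s • x)) 0 (t - t) := by
      rw [sub_self]; exact h (t • x) x
    have h2 := h1.comp_sub_const t t
    refine h2.congr_of_eventuallyEq (Filter.Eventually.of_forall fun s => ?_)
    simp only [← add_smul, add_sub_cancel]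
  have := is_const_of_deriv_eq_zero (fun t => (hd t).differentiableAt) (fun t => (hd t).deriv) 1 0
  simpa using this

theorem isMomentMap_iff (μ : V n m → Module.Dual ℂ (sp n)) :
    IsMomentMap n m μ ↔ ∀ (X : V n m) (A : sp n), μ X A =
      ((A : Matrix (Fin n ⊕ Fin n) (Fin n ⊕ Fin n) ℂ) *
        ((1 / 2 : ℂ) • momentMatrix X)).trace := by
  constructor
  · intro hμ X A
    have hconst : ∀ (X : V n m) (A : sp n),
        μ X A - momentFunction (A : Matrix _ _ ℂ) X = μ 0 A := by
      intro X A
      have h := eq_of_hasLineDerivAt_zero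
        (f := fun Y => μ Y A - momentFunction (A : Matrix _ _ ℂ) Y)
        (fun x v => by
          have := HasDerivAt.sub (hμ.deriv x v A) (hasLineDerivAt_momentFunction A.2 x v)
          rw [sub_self] at this
          exact this) X
      refine h.trans ?_
      simp [momentFunction, momentMatrix]
    have h0 : μ 0 = 0 := eq_zero_of_adjoint_invariant _ fun g hg A B hB => by
      have := hμ.equivariant g hg 0 A B hB
      rwa [Matrix.mul_zero] at this
    have := hconst X A
    rw [h0, LinearMap.zero_apply, sub_eq_zero] at this
    exact this
  · intro hμ
    refine ⟨fun g hg X A B hB => ?_, fun X ξ A => ?_⟩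
    · rw [hμ, hμ, hB]
      exact momentFunction_smul_equivariant hg X A
    · simp only [hμ]
      exact hasLineDerivAt_momentFunction A.2 X ξ

end MomentMap

section ZeroFibre

open Matrix

lemma mul_Q_mul_transpose_apply {ι : Type*} {m : ℕ} {R : Type*} [CommRing R]
    (X : Matrix ι (Fin m ⊕ Fin m) R) (i j : ι) :
    (X * Q m R * Xᵀ) i j = hyperbolic (X i) (X j) := by
  rw [hyperbolic]
  simp [Q, Matrix.mul_apply, fromBlocks, Fintype.sum_sum_type, one_apply, Finset.sum_add_distrib,
    add_comm]

lemma span_range_mul_le {R κ : Type*} [CommRing R] [Fintype κ] (G N : Matrix κ κ R) :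
    Ideal.span (Set.range fun p : κ × κ => (G * N) p.1 p.2) ≤
      Ideal.span (Set.range fun p : κ × κ => G p.1 p.2) := by
  rw [Ideal.span_le]
  rintro _ ⟨p, rfl⟩
  simp only [Matrix.mul_apply]
  exact Ideal.sum_mem _ fun l _ => Ideal.mul_mem_right _ _ (Ideal.subset_span ⟨(p.1, l), rfl⟩)

lemma momentIdeal_eq_gramIdeal (n m : ℕ) :
    momentIdeal n m = gramIdeal (Fin n ⊕ Fin n) (Fin m) ℂ := by
  set X := mvPolynomialX (Fin n ⊕ Fin n) (Fin m ⊕ Fin m) ℂ with hX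
  have hG : gramIdeal (Fin n ⊕ Fin n) (Fin m) ℂ = Ideal.span (Set.range
      fun p : (Fin n ⊕ Fin n) × (Fin n ⊕ Fin n) => (X * Q m (coordRing n m) * Xᵀ) p.1 p.2) := by
    simp only [mul_Q_mul_transpose_apply]
    rfl
  rw [hG, momentIdeal, ← hX]
  refine le_antisymm (span_range_mul_le (X * Q m (coordRing n m) * Xᵀ) (J n (coordRing n m))) ?_
  have h : X * Q m (coordRing n m) * Xᵀ = momentMatrix X * (-J n (coordRing n m)) := by
    rw [momentMatrix, Matrix.mul_assoc _ (J n (coordRing n m)), mul_neg, J_mul_J, neg_neg,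
      Matrix.mul_one]
  conv_lhs => rw [h]
  exact span_range_mul_le _ _

lemma isNormalRing_of_isIntegrallyClosed (R : Type*) [CommRing R] [IsDomain R]
    [IsIntegrallyClosed R] : IsNormalRing R := fun p _ =>
  ⟨IsLocalization.isDomain_localization p.primeCompl_le_nonZeroDivisors,
    isIntegrallyClosed_of_isLocalization _ _ p.primeCompl_le_nonZeroDivisors⟩

end ZeroFibre

end SpMoment

theorem mainTheorem2 (n m : ℕ) :
    -- the moment map of the action is `X ↦ ½ X Q Xᵗ J`, read in `𝔰𝔭_{2n}^*` by the trace form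
    (∀ μ : SpMoment.V n m → Module.Dual ℂ (SpMoment.sp n), SpMoment.IsMomentMap n m μ ↔
      ∀ (X : SpMoment.V n m) (A : SpMoment.sp n), μ X A =
        ((A : Matrix (Fin n ⊕ Fin n) (Fin n ⊕ Fin n) ℂ) *
          ((1 / 2 : ℂ) • SpMoment.momentMatrix X)).trace) ∧
    (2 * n ≤ m →
      IsReduced (SpMoment.zeroFibreRing n m) ∧
      SpMoment.IsCompleteIntersection (SpMoment.momentIdeal n m) ∧
      ringKrullDim (SpMoment.zeroFibreRing n m) + ((2 * n ^ 2 + n : ℕ) : WithBot ℕ∞) =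
        ((4 * m * n : ℕ) : WithBot ℕ∞)) ∧
    (2 * n + 1 ≤ m → SpMoment.IsNormalRing (SpMoment.zeroFibreRing n m)) := by
  refine ⟨SpMoment.isMomentMap_iff, fun h => ?_, fun h => ?_⟩
  · obtain ⟨hrad, r, f, hr, hspan, hdim⟩ :=
      SpMoment.exists_generators_gramIdeal ℂ (ι := Fin n ⊕ Fin n) (α := Fin m)
        (by simp only [Fintype.card_sum, Fintype.card_fin]; omega)
    rw [← SpMoment.momentIdeal_eq_gramIdeal] at hrad hspan hdim
    refine ⟨(Ideal.isRadical_iff_quotient_reduced _).1 hrad, ⟨r, f, hspan, hdim⟩, ?_⟩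
    simp only [Fintype.card_prod, Fintype.card_sum, Fintype.card_fin] at hr hdim
    have hr' : r = 2 * n ^ 2 + n := by
      refine Nat.eq_of_mul_eq_mul_left two_pos ?_
      rw [hr]
      ring
    rw [← hr', hdim]
    congr 1
    ring
  · obtain ⟨h1, h2⟩ := SpMoment.isIntegrallyClosed_gramRing ℂ (Fin n ⊕ Fin n) (Fin m)
      (by simp only [Fintype.card_sum, Fintype.card_fin]; omega)
    change SpMoment.IsNormalRing (SpMoment.coordRing n m ⧸ SpMoment.momentIdeal n m)
    rw [SpMoment.momentIdeal_eq_gramIdeal]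
    exact SpMoment.isNormalRing_of_isIntegrallyClosed _
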